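/- Let $R=R_{\bar 0}\oplus R_{\bar 1}$ be a nonzero $\mathbb{Z}/2$-graded unital ring that is supercommutative, i.e. $xy=(-1)^{|x||y|}yx$ for homogeneous $x,y$. Assume that $2$ is a non-zerodivisor in $R$ and that $R$ is Noetherian, i.e. satisfies the ascending chain condition on $\mathbb{Z}/2$-graded ideals. An $R$-supermodule is a left $R$-module $M=M_{\bar 0}\oplus M_{\bar 1}$ with $R_iM_j\subseteq M_{i+j}$; it is also a right module via $mr=(-1)^{|r||m|}rm$. Isomorphisms of supermodules are bijective $R$-linear maps preserving parity. For a multiplicative set $S\subseteq R_{\bar 0}$ let $S^{-1}M=S^{-1}M_{\bar 0}\oplus S^{-1}M_{\bar 1}$; for a prime ideal $\mathfrak p$ of $R$ the subscript $\mathfrak p$ denotes localization at $R_{\bar 0}\setminus\mathfrak p$. Let $K(R)=S^{-1}R$, where $S$ is the set of even elements that are non-zerodivisors of $R$. A supermodule $M$ is invertible if it is generated by finitely many homogeneous elements and $M_{\mathfrak p}\simeq R_{\mathfrak p}$ as $R_{\mathfrak p}$-supermodules for every prime ideal $\mathfrak p$ of $R$. 1. The isomorphism classes of invertible $R$-supermodules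 form an abelian group $\mathbf{Pic}_+(R)$ under $[M]\cdot[N]=[M\otimes_R N]$. Its identity is $[R]$ and $[M]^{-1}=[M^\vee]$, where $M^\vee=\underline{\mathrm{Hom}}_R(M,R)$ consists of all (even, odd and mixed) additive maps $\psi:M\to R$ with $\psi(mr)=\psi(m)r$, and $R$ acts on it by $(a\psi)(m)=a\psi(m)$. 2. The invertible $R$-subsupermodules of $K(R)$ form an abelian group $\mathbf{Cart}(R)$ under the product of submodules. Its identity is (the image of) $R$, and the inverse of $N$ is the $R$-submodule $N^{-1}$ of $K(R)$ generated by the homogeneous $d\in K(R)$ with $dN\subseteq R$. 3. Write $K(R)_{\bar 0}^*$ for the group of units of the ring $K(R)_{\bar 0}$. The map $\delta:K(R)_{\bar 0}^*\to\mathbf{Cart}(R)$, $u\mapsto uR$, and the map $\psi:\mathbf{Cart}(R)\to\mathbf{Pic}_+(R)$, $N\mapsto[N]$, are well-defined group homomorphisms. The map $\psi$ is surjective, and $\ker\psi=\{\,uR : u\in K(R)_{\bar 0}^*\,\}$. 4. Consequently $\psi$ induces an isomorphism from the ideal class group $\mathbf{Cart}(R)/K(R)_{\bar 0}^*$, meaning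 the quotient of $\mathbf{Cart}(R)$ by the image of $\delta$, onto $\mathbf{Pic}_+(R)$. -/

import Mathlib

open scoped OreLocalization TensorProduct

universe u

/-- Supercommutativity of a `ℤ/2`-graded ring: `x y = (-1)^{|x||y|} y x` for homogeneous `x, y`. -/
class SuperCommutative {R : Type u} [Ring R] (𝓡 : ZMod 2 → AddSubgroup R) : Prop where
  comm : ∀ {i j : ZMod 2} {x y : R}, x ∈ 𝓡 i → y ∈ 𝓡 j →
    x * y = ((-1 : ℤˣ) ^ (i * j)) • (y * x)

/-- A superring is Noetherian if it has the ascending chain condition on superideals. -/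
def NoetherianSuperring {R : Type u} [Ring R] (𝓡 : ZMod 2 → AddSubgroup R) [GradedRing 𝓡] : Prop :=
  WellFoundedGT (HomogeneousIdeal 𝓡)

/-- `𝓜` makes the left `R`-module `M` an `R`-supermodule: `M = M₀ ⊕ M₁` and `Rᵢ Mⱼ ⊆ Mᵢ₊ⱼ`. -/
class IsSupermodule {R : Type u} [Ring R] (𝓡 : ZMod 2 → AddSubgroup R)
    {M : Type u} [AddCommGroup M] [Module R M] (𝓜 : ZMod 2 → AddSubgroup M) : Prop where
  isCompl : IsCompl (𝓜 0) (𝓜 1)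
  smul_mem : ∀ {i j : ZMod 2} {r : R} {m : M}, r ∈ 𝓡 i → m ∈ 𝓜 j → r • m ∈ 𝓜 (i + j)

/-- A (bundled) `R`-supermodule. -/
structure SuperModule {R : Type u} [Ring R] (𝓡 : ZMod 2 → AddSubgroup R) : Type (u + 1) where
  carrier : Type u
  [addCommGroup : AddCommGroup carrier]
  [module : Module R carrier]
  gr : ZMod 2 → AddSubgroup carrier
  [isSupermodule : IsSupermodule 𝓡 gr]

attribute [instance] SuperModule.addCommGroup SuperModule.module SuperModule.isSupermodule

section Gradings

variable {A : Type u} [AddCommGroup A] {G : ZMod 2 → AddSubgroup A}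

theorem zmod_two_cases (i : ZMod 2) : i = 0 ∨ i = 1 := by
  revert i; decide

theorem units_smul_mem (H : AddSubgroup A) (e : ℤˣ) {x : A} (hx : x ∈ H) : e • x ∈ H := by
  rcases Int.units_eq_one_or e with rfl | rfl
  · simpa using hx
  · simpa using hx

theorem exists_add_of_isCompl (h : IsCompl (G 0) (G 1)) (x : A) :
    ∃ a ∈ G 0, ∃ b ∈ G 1, a + b = x := by
  have : x ∈ G 0 ⊔ G 1 := by rw [h.sup_eq_top]; trivial
  exact AddSubgroup.mem_sup.1 this

theorem eq_zero_of_isCompl (h : IsCompl (G 0) (G 1)) {x : A} (h0 : x ∈ G 0) (h1 : x ∈ G 1) :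
    x = 0 := by
  have : x ∈ G 0 ⊓ G 1 := ⟨h0, h1⟩
  rwa [h.inf_eq_bot, AddSubgroup.mem_bot] at this

theorem exists_proj (h : IsCompl (G 0) (G 1)) :
    ∃ π : ZMod 2 → A →+ A, (∀ i x, π i x ∈ G i) ∧ (∀ x, π 0 x + π 1 x = x) := by
  choose a ha b hb hab using exists_add_of_isCompl h
  have key : ∀ x y, a (x + y) = a x + a y ∧ b (x + y) = b x + b y := by
    intro x y
    have e : a (x + y) - (a x + a y) = (b x + b y) - b (x + y) := by
      rw [sub_eq_sub_iff_add_eq_add, hab (x + y)]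
      nth_rewrite 1 [← hab x, ← hab y]
      abel
    have z : a (x + y) - (a x + a y) = 0 := by
      apply eq_zero_of_isCompl h
      · exact sub_mem (ha _) (add_mem (ha _) (ha _))
      · rw [e]; exact sub_mem (add_mem (hb _) (hb _)) (hb _)
    refine ⟨sub_eq_zero.1 z, ?_⟩
    rw [z] at e
    exact (sub_eq_zero.1 e.symm).symm
  refine ⟨fun i => if i = 0 then AddMonoidHom.mk' a fun x y => (key x y).1
    else AddMonoidHom.mk' b fun x y => (key x y).2, ?_, ?_⟩
  · intro i x
    rcases zmod_two_cases i with rfl | rfl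
    · simpa using ha x
    · simpa using hb x
  · intro x
    simpa using hab x

/-- The projection of `A = G 0 ⊕ G 1` onto `G i`. -/
noncomputable def grProj (h : IsCompl (G 0) (G 1)) : ZMod 2 → A →+ A := (exists_proj h).choose

theorem grProj_mem (h : IsCompl (G 0) (G 1)) (i : ZMod 2) (x : A) : grProj h i x ∈ G i :=
  (exists_proj h).choose_spec.1 i x

theorem grProj_add (h : IsCompl (G 0) (G 1)) (x : A) : grProj h 0 x + grProj h 1 x = x :=
  (exists_proj h).choose_spec.2 x

theorem grProj_unique (h : IsCompl (G 0) (G 1)) {a b x : A} (ha : a ∈ G 0) (hb : b ∈ G 1)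
    (hx : a + b = x) : grProj h 0 x = a ∧ grProj h 1 x = b := by
  have e : grProj h 0 x - a = b - grProj h 1 x := by
    rw [sub_eq_sub_iff_add_eq_add, grProj_add, ← hx, add_comm]
  have z : grProj h 0 x - a = 0 := by
    apply eq_zero_of_isCompl h
    · exact sub_mem (grProj_mem h 0 x) ha
    · rw [e]; exact sub_mem hb (grProj_mem h 1 x)
  refine ⟨sub_eq_zero.1 z, ?_⟩
  rw [z] at e
  exact (sub_eq_zero.1 e.symm).symm

theorem grProj_same (h : IsCompl (G 0) (G 1)) {i : ZMod 2} {x : A} (hx : x ∈ G i) :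
    grProj h i x = x := by
  rcases zmod_two_cases i with rfl | rfl
  · exact (grProj_unique h hx (zero_mem _) (add_zero x)).1
  · exact (grProj_unique h (zero_mem _) hx (zero_add x)).2

theorem grProj_other (h : IsCompl (G 0) (G 1)) {i : ZMod 2} {x : A} (hx : x ∈ G i) :
    grProj h (i + 1) x = 0 := by
  rcases zmod_two_cases i with rfl | rfl
  · exact (grProj_unique h hx (zero_mem _) (add_zero x)).2
  · exact (grProj_unique h (zero_mem _) hx (zero_add x)).1

theorem isCompl_of_proj (π : ZMod 2 → A →+ A) (hm : ∀ i x, π i x ∈ G i)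
    (ha : ∀ x, π 0 x + π 1 x = x) (h0 : ∀ i, ∀ x ∈ G i, π (i + 1) x = 0) :
    IsCompl (G 0) (G 1) := by
  constructor
  · rw [disjoint_iff_inf_le]
    rintro x ⟨hx0, hx1⟩
    have e1 : π 1 x = 0 := by simpa using h0 0 x hx0
    have e0 : π 0 x = 0 := h0 1 x hx1
    rw [AddSubgroup.mem_bot, ← ha x, e0, e1, add_zero]
  · rw [codisjoint_iff_le_sup]
    intro x _
    rw [← ha x]
    exact AddSubgroup.add_mem_sup (hm 0 x) (hm 1 x)

theorem mem_of_equiv {B : Type u} [AddCommGroup B] {H : ZMod 2 → AddSubgroup B}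
    (hG : IsCompl (G 0) (G 1)) (hH : IsCompl (H 0) (H 1)) (e : A ≃+ B)
    (he : ∀ i, ∀ x ∈ G i, e x ∈ H i) : ∀ i, ∀ y ∈ H i, e.symm y ∈ G i := by
  intro i y hy
  have hs : e (grProj hG 0 (e.symm y)) + e (grProj hG 1 (e.symm y)) = y := by
    rw [← map_add, grProj_add, e.apply_symm_apply]
  obtain ⟨u0, u1⟩ := grProj_unique hH (he 0 _ (grProj_mem hG 0 _)) (he 1 _ (grProj_mem hG 1 _)) hs
  have hi : grProj hH i y = e (grProj hG i (e.symm y)) := by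
    rcases zmod_two_cases i with rfl | rfl
    · exact u0
    · exact u1
  rw [grProj_same hH hy] at hi
  rw [hi, e.symm_apply_apply]
  exact grProj_mem hG i _

end Gradings

section Localization

variable {R : Type u} [Ring R] (𝓡 : ZMod 2 → AddSubgroup R) [GradedRing 𝓡]

instance superring_isSupermodule : IsSupermodule 𝓡 𝓡 where
  isCompl := by
    constructor
    · rw [disjoint_iff_inf_le]
      rintro x ⟨h0, h1⟩
      rw [AddSubgroup.mem_bot]
      have := DirectSum.decompose_of_mem_same 𝓡 h0
      rw [DirectSum.decompose_of_mem_ne 𝓡 h1 (by decide)] at this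
      exact this.symm
    · rw [codisjoint_iff_le_sup]
      intro x _
      have h : (DirectSum.decompose 𝓡 x 0 : R) + DirectSum.decompose 𝓡 x 1 = x := by
        classical
        have := DirectSum.sum_support_decompose 𝓡 x
        rw [Finset.sum_subset (Finset.subset_univ _)] at this
        · exact (Fin.sum_univ_two _).symm.trans this
        · intro i _ hi
          simpa using hi
      rw [← h]
      exact AddSubgroup.add_mem_sup (SetLike.coe_mem _) (SetLike.coe_mem _)
  smul_mem := fun hr hm => SetLike.mul_mem_graded hr hm

/-- The multiplicative set `T ∩ R₀` of even elements of `T`. -/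
def evenPart (T : Submonoid R) : Submonoid R where
  carrier := {s | s ∈ T ∧ s ∈ 𝓡 0}
  one_mem' := ⟨one_mem T, SetLike.one_mem_graded 𝓡⟩
  mul_mem' := fun ha hb => ⟨mul_mem ha.1 hb.1, by
    simpa using SetLike.mul_mem_graded ha.2 hb.2⟩

variable [SuperCommutative 𝓡]

theorem even_comm {s : R} (hs : s ∈ 𝓡 0) (r : R) : s * r = r * s := by
  obtain ⟨a, ha, b, hb, rfl⟩ := exists_add_of_isCompl (IsSupermodule.isCompl 𝓡 (𝓜 := 𝓡)) r
  rw [mul_add, add_mul, SuperCommutative.comm hs ha, SuperCommutative.comm hs hb]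
  simp

/-- Even elements are central, so the set of all fractions `s⁻¹ r` is the Ore localization. -/
instance evenPartOreSet (T : Submonoid R) : OreLocalization.OreSet (evenPart 𝓡 T) where
  ore_right_cancel := fun r₁ r₂ s h => ⟨s, by
    rw [even_comm 𝓡 s.2.2, even_comm 𝓡 s.2.2, h]⟩
  oreNum := fun r _ => r
  oreDenom := fun _ s => s
  ore_eq := fun r s => even_comm 𝓡 s.2.2 r

variable {M : Type u} [AddCommGroup M] [Module R M] (𝓜 : ZMod 2 → AddSubgroup M)
  [IsSupermodule 𝓡 𝓜]

/-- The grading `(S⁻¹M)ᵢ = S⁻¹(Mᵢ)` of the localization of a supermodule at `S = T ∩ R₀`. -/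
def locGr (T : Submonoid R) (i : ZMod 2) : AddSubgroup (M[(evenPart 𝓡 T)⁻¹]) where
  carrier := {x | ∃ m ∈ 𝓜 i, ∃ s : evenPart 𝓡 T, x = m /ₒ s}
  zero_mem' := ⟨0, zero_mem _, 1, by simp⟩
  neg_mem' := by
    rintro _ ⟨m, hm, s, rfl⟩
    exact ⟨-m, neg_mem hm, s, by simp⟩
  add_mem' := by
    rintro _ _ ⟨m, hm, s, rfl⟩ ⟨n, hn, t, rfl⟩
    refine ⟨(t : R) • m + (s : R) • n, add_mem ?_ ?_, t * s, ?_⟩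
    · simpa using IsSupermodule.smul_mem (𝓡 := 𝓡) t.2.2 hm
    · simpa using IsSupermodule.smul_mem (𝓡 := 𝓡) s.2.2 hn
    · exact OreLocalization.oreDiv_add_char s t (s : R) t (even_comm 𝓡 t.2.2 s)

theorem locGr_isCompl (T : Submonoid R) : IsCompl (locGr 𝓡 𝓜 T 0) (locGr 𝓡 𝓜 T 1) := by
  have hM := IsSupermodule.isCompl 𝓡 (𝓜 := 𝓜)
  constructor
  · rw [disjoint_iff_inf_le]
    rintro x ⟨⟨m, hm, s, rfl⟩, ⟨n, hn, t, h⟩⟩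
    rw [AddSubgroup.mem_bot, h]
    obtain ⟨v, w, h1, h2⟩ := OreLocalization.oreDiv_eq_iff.1 h
    have hz : (s * v) • n = 0 := by
      apply eq_zero_of_isCompl hM
      · have : (s * v) • n = ((v * t : evenPart 𝓡 T) : R) • m := by
          rw [mul_smul, h1, Submonoid.coe_mul, h2, Submonoid.smul_def, smul_smul,
            even_comm 𝓡 s.2.2]
        have h0 := IsSupermodule.smul_mem (𝓡 := 𝓡) (v * t).2.2 hm
        rwa [this, ← zero_add (0 : ZMod 2)]
      · have := IsSupermodule.smul_mem (𝓡 := 𝓡) (s * v).2.2 hn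
        rwa [zero_add] at this
    rw [OreLocalization.expand' n t (s * v), hz, OreLocalization.zero_oreDiv]
  · rw [codisjoint_iff_le_sup]
    intro x _
    induction x with | _ m s
    obtain ⟨a, ha, b, hb, rfl⟩ := exists_add_of_isCompl hM m
    rw [← OreLocalization.add_oreDiv]
    exact AddSubgroup.add_mem_sup ⟨a, ha, s, rfl⟩ ⟨b, hb, s, rfl⟩

instance locGr_isSupermodule (T : Submonoid R) : IsSupermodule 𝓡 (locGr 𝓡 𝓜 T) where
  isCompl := locGr_isCompl 𝓡 𝓜 T
  smul_mem := by
    rintro i j r _ hr ⟨m, hm, s, rfl⟩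
    refine ⟨r • m, IsSupermodule.smul_mem hr hm, s, ?_⟩
    rw [← OreLocalization.oreDiv_one_smul,
      OreLocalization.oreDiv_smul_char r m 1 s r s (even_comm 𝓡 s.2.2 r), mul_one]

/-- The total superring of fractions `K(R) = S⁻¹R`, where `S` is the set of even elements that are
non-zerodivisors of `R`. -/
abbrev TotalFractions : Type u := R[(evenPart 𝓡 (nonZeroDivisors R))⁻¹]

/-- The grading of `K(R)`. -/
abbrev fracGr (i : ZMod 2) : AddSubgroup (TotalFractions 𝓡) := locGr 𝓡 𝓡 (nonZeroDivisors R) i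

end Localization

namespace SuperModule

set_option linter.unusedSectionVars false

variable {R : Type u} [Ring R] (𝓡 : ZMod 2 → AddSubgroup R) [GradedRing 𝓡]

/-- `R` as a supermodule over itself. -/
abbrev self : SuperModule 𝓡 where
  carrier := R
  gr := 𝓡

variable {𝓡}

/-- `M` and `N` are isomorphic: there is a bijective `R`-linear map preserving the parity. -/
def Isomorphic (M N : SuperModule 𝓡) : Prop :=
  ∃ e : M.carrier ≃ₗ[R] N.carrier, ∀ i, ∀ x ∈ M.gr i, e x ∈ N.gr i

theorem Isomorphic.refl (M : SuperModule 𝓡) : M.Isomorphic M :=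
  ⟨LinearEquiv.refl R _, fun _ _ h => h⟩

theorem Isomorphic.symm {M N : SuperModule 𝓡} : M.Isomorphic N → N.Isomorphic M := by
  rintro ⟨e, he⟩
  exact ⟨e.symm, mem_of_equiv (IsSupermodule.isCompl 𝓡) (IsSupermodule.isCompl 𝓡) e.toAddEquiv he⟩

theorem Isomorphic.trans {M N P : SuperModule 𝓡} :
    M.Isomorphic N → N.Isomorphic P → M.Isomorphic P := by
  rintro ⟨e, he⟩ ⟨f, hf⟩
  exact ⟨e.trans f, fun i x hx => hf i _ (he i x hx)⟩

/-- The projection of `M` onto its component of degree `i`. -/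
noncomputable def proj (M : SuperModule 𝓡) (i : ZMod 2) : M.carrier →+ M.carrier :=
  grProj (IsSupermodule.isCompl 𝓡 (𝓜 := M.gr)) i

theorem proj_mem (M : SuperModule 𝓡) (i : ZMod 2) (m : M.carrier) : M.proj i m ∈ M.gr i :=
  grProj_mem _ i m

theorem proj_add (M : SuperModule 𝓡) (m : M.carrier) : M.proj 0 m + M.proj 1 m = m :=
  grProj_add _ m

theorem proj_same (M : SuperModule 𝓡) {i : ZMod 2} {m : M.carrier} (h : m ∈ M.gr i) :
    M.proj i m = m := grProj_same _ h

theorem proj_other (M : SuperModule 𝓡) {i : ZMod 2} {m : M.carrier} (h : m ∈ M.gr i) :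
    M.proj (i + 1) m = 0 := grProj_other _ h

variable (𝓡) in
/-- The projection of `R` onto its component of degree `i`. -/
noncomputable def rproj (i : ZMod 2) : R →+ R := grProj (IsSupermodule.isCompl 𝓡 (𝓜 := 𝓡)) i

variable (𝓡) in
theorem rproj_mem (i : ZMod 2) (m : R) : rproj 𝓡 i m ∈ 𝓡 i := grProj_mem _ i m

variable (𝓡) in
theorem rproj_add (m : R) : rproj 𝓡 0 m + rproj 𝓡 1 m = m := grProj_add _ m

variable (𝓡) in
theorem rproj_same {i : ZMod 2} {m : R} (h : m ∈ 𝓡 i) : rproj 𝓡 i m = m := grProj_same _ h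

variable (𝓡) in
theorem rproj_other {i : ZMod 2} {m : R} (h : m ∈ 𝓡 i) : rproj 𝓡 (i + 1) m = 0 :=
  grProj_other _ h

theorem proj_smul (M : SuperModule 𝓡) (a : R) (m : M.carrier) (i : ZMod 2) :
    M.proj i (a • m) =
      rproj 𝓡 0 a • M.proj i m + rproj 𝓡 1 a • M.proj (i + 1) m := by
  have ha := rproj_add 𝓡 a
  have hm := M.proj_add m
  have h (k l : ZMod 2) : rproj 𝓡 k a • M.proj l m ∈ M.gr (k + l) :=
    IsSupermodule.smul_mem (rproj_mem 𝓡 k a) (M.proj_mem l m)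
  have key := grProj_unique (IsSupermodule.isCompl 𝓡 (𝓜 := M.gr)) (x := a • m)
    (add_mem (h 0 0) (h 1 1)) (add_mem (h 0 1) (h 1 0)) (by
      conv_rhs => rw [← hm, ← ha, smul_add, add_smul, add_smul]
      abel)
  rcases zmod_two_cases i with rfl | rfl
  · exact key.1
  · exact key.2

section Tensor

variable (M N : SuperModule 𝓡)

/-- The relations `(m r) ⊗ n = m ⊗ (r n)`, where `m r = (-1)^{|r||m|} r m` is the right action. -/
def tensorRel : Set (M.carrier ⊗[ℤ] N.carrier) :=
  {x | ∃ (i j : ZMod 2) (r : R) (m : M.carrier) (n : N.carrier), r ∈ 𝓡 i ∧ m ∈ M.gr j ∧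
    x = (((-1 : ℤˣ) ^ (i * j)) • (r • m)) ⊗ₜ[ℤ] n - m ⊗ₜ[ℤ] (r • n)}

/-- The `R`-submodule generated by the relations; `R` acts on `M ⊗[ℤ] N` through the left factor.
By supercommutativity, the additive subgroup generated by the relations is already an
`R`-submodule, so the quotient is the tensor product of the right `R`-module `M` and the left
`R`-module `N`. -/
def tensorRelSubmodule : Submodule R (M.carrier ⊗[ℤ] N.carrier) :=
  Submodule.span R (tensorRel M N)

/-- The component of degree `k` of `M ⊗[ℤ] N`. -/
def tensorIntGr (k : ZMod 2) : AddSubgroup (M.carrier ⊗[ℤ] N.carrier) :=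
  AddSubgroup.closure {x | ∃ (i j : ZMod 2) (m : M.carrier) (n : N.carrier),
    m ∈ M.gr i ∧ n ∈ N.gr j ∧ i + j = k ∧ x = m ⊗ₜ[ℤ] n}

/-- The component of degree `k` of `M ⊗[R] N`. -/
def tensorGr (k : ZMod 2) :
    AddSubgroup ((M.carrier ⊗[ℤ] N.carrier) ⧸ tensorRelSubmodule M N) :=
  (tensorIntGr M N k).map (tensorRelSubmodule M N).mkQ.toAddMonoidHom

/-- The projection of `M ⊗[ℤ] N` onto its component of degree `k`. -/
noncomputable def tensorProj (k : ZMod 2) :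
    M.carrier ⊗[ℤ] N.carrier →+ M.carrier ⊗[ℤ] N.carrier :=
  (TensorProduct.map (M.proj 0).toIntLinearMap (N.proj k).toIntLinearMap +
    TensorProduct.map (M.proj 1).toIntLinearMap (N.proj (k + 1)).toIntLinearMap).toAddMonoidHom

theorem tensorProj_tmul (k : ZMod 2) (m : M.carrier) (n : N.carrier) :
    tensorProj M N k (m ⊗ₜ[ℤ] n) =
      M.proj 0 m ⊗ₜ[ℤ] N.proj k n + M.proj 1 m ⊗ₜ[ℤ] N.proj (k + 1) n := rfl

theorem tmul_mem_tensorIntGr {i j : ZMod 2} {m : M.carrier} {n : N.carrier} (hm : m ∈ M.gr i)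
    (hn : n ∈ N.gr j) : m ⊗ₜ[ℤ] n ∈ tensorIntGr M N (i + j) :=
  AddSubgroup.subset_closure ⟨i, j, m, n, hm, hn, rfl, rfl⟩

theorem tensorProj_homogeneous {i j : ZMod 2} {m : M.carrier} {n : N.carrier} (hm : m ∈ M.gr i)
    (hn : n ∈ N.gr j) : tensorProj M N (i + j) (m ⊗ₜ[ℤ] n) = m ⊗ₜ[ℤ] n ∧
      tensorProj M N (i + j + 1) (m ⊗ₜ[ℤ] n) = 0 := by
  have a1 := M.proj_same hm
  have a2 := M.proj_other hm
  have b1 := N.proj_same hn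
  have b2 := N.proj_other hn
  rw [tensorProj_tmul, tensorProj_tmul]
  have e : (1 : ZMod 2) + 1 = 0 := by decide
  rcases zmod_two_cases i with rfl | rfl
  · rw [zero_add] at a2
    simp [a1, a2, b1, b2]
  · rw [e] at a2
    have e1 : (1 : ZMod 2) + j = j + 1 := add_comm _ _
    have e2 : j + 1 + 1 = j := by rw [add_assoc, e, add_zero]
    simp [a1, a2, b1, b2, e1, e2]

theorem tensorProj_add (x : M.carrier ⊗[ℤ] N.carrier) :
    tensorProj M N 0 x + tensorProj M N 1 x = x := by
  induction x with
  | zero => simp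
  | add x y hx hy =>
    rw [map_add, map_add]
    nth_rewrite 3 [← hx, ← hy]
    abel
  | tmul m n =>
    rw [tensorProj_tmul, tensorProj_tmul]
    have e : (1 : ZMod 2) + 1 = 0 := by decide
    have h1 := M.proj_add m
    have h2 := N.proj_add n
    rw [e, zero_add]
    conv_rhs => rw [← h1, ← h2, TensorProduct.add_tmul, TensorProduct.tmul_add,
      TensorProduct.tmul_add]
    abel

theorem tensorProj_mem (k : ZMod 2) (x : M.carrier ⊗[ℤ] N.carrier) :
    tensorProj M N k x ∈ tensorIntGr M N k := by
  induction x with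
  | zero => rw [map_zero]; exact zero_mem _
  | add x y hx hy => rw [map_add]; exact add_mem hx hy
  | tmul m n =>
    rw [tensorProj_tmul]
    have e : (1 : ZMod 2) + (k + 1) = k := by revert k; decide
    have h0 := tmul_mem_tensorIntGr M N (M.proj_mem 0 m) (N.proj_mem k n)
    have h1 := tmul_mem_tensorIntGr M N (M.proj_mem 1 m) (N.proj_mem (k + 1) n)
    rw [zero_add] at h0
    rw [e] at h1
    exact add_mem h0 h1

theorem tensorProj_same (k : ZMod 2) {x : M.carrier ⊗[ℤ] N.carrier}
    (hx : x ∈ tensorIntGr M N k) :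
    tensorProj M N k x = x ∧ tensorProj M N (k + 1) x = 0 := by
  induction hx using AddSubgroup.closure_induction with
  | mem x hx =>
    obtain ⟨i, j, m, n, hm, hn, rfl, rfl⟩ := hx
    exact tensorProj_homogeneous M N hm hn
  | zero => simp
  | add x y _ _ hx hy => simp [hx.1, hx.2, hy.1, hy.2]
  | neg x _ hx => simp [hx.1, hx.2]

theorem tensorProj_smul (k : ZMod 2) (a : R) (x : M.carrier ⊗[ℤ] N.carrier) :
    tensorProj M N k (a • x) = rproj 𝓡 0 a • tensorProj M N k x +
      rproj 𝓡 1 a • tensorProj M N (k + 1) x := by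
  induction x with
  | zero => simp
  | add x y hx hy =>
    rw [smul_add, map_add, hx, hy, map_add, map_add, smul_add, smul_add]
    abel
  | tmul m n =>
    have e : (1 : ZMod 2) + 1 = 0 := by decide
    have e2 : k + 1 + 1 = k := by rw [add_assoc, e, add_zero]
    rw [TensorProduct.smul_tmul', tensorProj_tmul, tensorProj_tmul, tensorProj_tmul, proj_smul,
      proj_smul, TensorProduct.add_tmul, TensorProduct.add_tmul, e, e2, zero_add, smul_add,
      smul_add]
    simp only [TensorProduct.smul_tmul']
    abel_nf

theorem tensorProj_rel (k : ZMod 2) {x : M.carrier ⊗[ℤ] N.carrier}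
    (hx : x ∈ tensorRelSubmodule M N) : tensorProj M N k x ∈ tensorRelSubmodule M N := by
  induction hx using Submodule.span_induction generalizing k with
  | zero => rw [map_zero]; exact zero_mem _
  | add x y _ _ hx hy => rw [map_add]; exact add_mem (hx k) (hy k)
  | smul a x _ hx =>
    rw [tensorProj_smul]
    exact add_mem (Submodule.smul_mem _ _ (hx k)) (Submodule.smul_mem _ _ (hx (k + 1)))
  | mem x hx =>
    obtain ⟨i, j, r, m, n, hr, hm, rfl⟩ := hx
    have main (l : ZMod 2) (n' : N.carrier) (hn : n' ∈ N.gr l) :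
        tensorProj M N k ((((-1 : ℤˣ) ^ (i * j)) • (r • m)) ⊗ₜ[ℤ] n' - m ⊗ₜ[ℤ] (r • n')) ∈
          tensorRelSubmodule M N := by
      have hy : (((-1 : ℤˣ) ^ (i * j)) • (r • m)) ⊗ₜ[ℤ] n' - m ⊗ₜ[ℤ] (r • n') ∈
          tensorIntGr M N (i + j + l) := by
        refine sub_mem (tmul_mem_tensorIntGr M N
          (units_smul_mem _ _ (IsSupermodule.smul_mem hr hm)) hn) ?_
        have := tmul_mem_tensorIntGr M N hm (IsSupermodule.smul_mem hr hn)
        rwa [← add_assoc, add_comm j i] at this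
      have hk : k = i + j + l ∨ k = i + j + l + 1 := by
        generalize i + j + l = d
        revert k d; decide
      rcases hk with rfl | rfl
      · rw [(tensorProj_same M N _ hy).1]
        exact Submodule.subset_span ⟨i, j, r, m, n', hr, hm, rfl⟩
      · rw [(tensorProj_same M N _ hy).2]
        exact zero_mem _
    have h0 := main 0 _ (N.proj_mem 0 n)
    have h1 := main 1 _ (N.proj_mem 1 n)
    have := add_mem h0 h1
    rw [← map_add] at this
    convert this using 2
    nth_rewrite 1 2 [← N.proj_add n]
    rw [TensorProduct.tmul_add, smul_add, TensorProduct.tmul_add]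
    abel

instance tensor_isSupermodule : IsSupermodule 𝓡 (tensorGr M N) where
  isCompl := by
    constructor
    · rw [disjoint_iff_inf_le]
      rintro _ ⟨⟨a, ha, rfl⟩, ⟨b, hb, hab⟩⟩
      have h : a - b ∈ tensorRelSubmodule M N := (Submodule.Quotient.eq _).1 hab.symm
      have h' := tensorProj_rel M N 0 h
      have e : tensorProj M N 0 b = 0 := (tensorProj_same M N 1 hb).2
      rw [map_sub, (tensorProj_same M N 0 ha).1, e, sub_zero] at h'
      exact (Submodule.Quotient.mk_eq_zero _).2 h'
    · rw [codisjoint_iff_le_sup]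
      intro x _
      obtain ⟨y, rfl⟩ := Submodule.mkQ_surjective _ x
      rw [← tensorProj_add M N y, map_add]
      exact AddSubgroup.add_mem_sup ⟨_, tensorProj_mem M N 0 y, rfl⟩
        ⟨_, tensorProj_mem M N 1 y, rfl⟩
  smul_mem := by
    rintro i j r _ hr ⟨a, ha, rfl⟩
    refine ⟨r • a, ?_, rfl⟩
    induction ha using AddSubgroup.closure_induction with
    | zero => rw [smul_zero]; exact zero_mem _
    | add x y _ _ hx hy => rw [smul_add]; exact add_mem hx hy
    | neg x _ hx => rw [smul_neg]; exact neg_mem hx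
    | mem x hx =>
      obtain ⟨k, l, m, n, hm, hn, rfl, rfl⟩ := hx
      rw [TensorProduct.smul_tmul', ← add_assoc]
      exact tmul_mem_tensorIntGr M N (IsSupermodule.smul_mem hr hm) hn

/-- The tensor product `M ⊗[R] N` of supermodules, with `r (m ⊗ n) = (r m) ⊗ n`. -/
abbrev tensor : SuperModule 𝓡 where
  carrier := (M.carrier ⊗[ℤ] N.carrier) ⧸ tensorRelSubmodule M N
  gr := tensorGr M N

end Tensor

section Dual

variable (M : SuperModule 𝓡)

/-- The additive maps `ψ : M → R` that are `R`-linear for the right actions,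
`ψ (m r) = ψ (m) r` with `m r = (-1)^{|r||m|} r m`; `R` acts by `(a ψ) (m) = a ψ (m)`. -/
def dualSubmodule : Submodule R (M.carrier →+ R) where
  carrier := {ψ | ∀ (i j : ZMod 2) (r : R) (m : M.carrier), r ∈ 𝓡 i → m ∈ M.gr j →
    ψ (((-1 : ℤˣ) ^ (i * j)) • (r • m)) = ψ m * r}
  zero_mem' := by
    intro i j r m _ _
    simp
  add_mem' := by
    intro f g hf hg i j r m hr hm
    rw [AddMonoidHom.add_apply, AddMonoidHom.add_apply, hf i j r m hr hm, hg i j r m hr hm,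
      add_mul]
  smul_mem' := by
    intro a f hf i j r m hr hm
    rw [AddMonoidHom.smul_apply, AddMonoidHom.smul_apply, hf i j r m hr hm, smul_eq_mul,
      smul_eq_mul, mul_assoc]

/-- The maps of parity `i`: those with `ψ (Mⱼ) ⊆ Rᵢ₊ⱼ`. -/
def dualGr (i : ZMod 2) : AddSubgroup (dualSubmodule M) where
  carrier := {ψ | ∀ (j : ZMod 2) (m : M.carrier), m ∈ M.gr j → ψ.1 m ∈ 𝓡 (i + j)}
  zero_mem' := fun _ _ _ => zero_mem _
  add_mem' := fun hf hg j m hm => add_mem (hf j m hm) (hg j m hm)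
  neg_mem' := fun hf j m hm => neg_mem (hf j m hm)

/-- The component of parity `k` of a map. -/
noncomputable def dualProjFun (k : ZMod 2) (ψ : M.carrier →+ R) : M.carrier →+ R :=
  ((rproj 𝓡 k).comp ψ).comp (M.proj 0) + ((rproj 𝓡 (k + 1)).comp ψ).comp (M.proj 1)

theorem dualProjFun_homogeneous (k : ZMod 2) (ψ : M.carrier →+ R) {j : ZMod 2} {m : M.carrier}
    (hm : m ∈ M.gr j) : dualProjFun M k ψ m = rproj 𝓡 (k + j) (ψ m) := by
  have a1 := M.proj_same hm
  have a2 := M.proj_other hm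
  change rproj 𝓡 k (ψ (M.proj 0 m)) + rproj 𝓡 (k + 1) (ψ (M.proj 1 m)) = _
  rcases zmod_two_cases j with rfl | rfl
  · rw [zero_add] at a2
    rw [a1, a2, map_zero, map_zero, add_zero, add_zero]
  · have e : (1 : ZMod 2) + 1 = 0 := by decide
    rw [e] at a2
    rw [a1, a2, map_zero, map_zero, zero_add]

theorem self_proj_mul {i : ZMod 2} {r : R} (hr : r ∈ 𝓡 i) (k : ZMod 2) (x : R) :
    rproj 𝓡 (k + i) (x * r) = rproj 𝓡 k x * r := by
  have h := rproj_add 𝓡 x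
  have hm (l : ZMod 2) : rproj 𝓡 l x * r ∈ 𝓡 (l + i) :=
    SetLike.mul_mem_graded (rproj_mem 𝓡 l x) hr
  have hx : x * r = rproj 𝓡 k x * r + rproj 𝓡 (k + 1) x * r := by
    conv_lhs => rw [← h]
    rcases zmod_two_cases k with rfl | rfl
    · exact add_mul _ _ _
    · exact (add_mul _ _ _).trans (add_comm _ _)
  have e : k + i = k + 1 + i + 1 := by
    clear hx hm hr h
    revert k i
    decide
  have s1 : rproj 𝓡 (k + i) (rproj 𝓡 k x * r) = rproj 𝓡 k x * r :=
    rproj_same 𝓡 (hm k)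
  have s2 : rproj 𝓡 (k + i) (rproj 𝓡 (k + 1) x * r) = 0 := by
    rw [e]
    exact rproj_other 𝓡 (hm (k + 1))
  rw [hx]
  rw [map_add, s1, s2, add_zero]

theorem dualProjFun_mem (k : ZMod 2) {ψ : M.carrier →+ R} (hψ : ψ ∈ dualSubmodule M) :
    dualProjFun M k ψ ∈ dualSubmodule M := by
  intro i j r m hr hm
  rw [dualProjFun_homogeneous M k ψ (units_smul_mem _ _ (IsSupermodule.smul_mem hr hm)),
    dualProjFun_homogeneous M k ψ hm, hψ i j r m hr hm, add_comm i j, ← add_assoc,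
    self_proj_mul hr]

instance dual_isSupermodule : IsSupermodule 𝓡 (dualGr M) where
  isCompl := by
    constructor
    · rw [disjoint_iff_inf_le]
      rintro ψ ⟨h0, h1⟩
      have hz (j : ZMod 2) (m : M.carrier) (hm : m ∈ M.gr j) : ψ.1 m = 0 := by
        have e0 := h0 j m hm
        have e1 := h1 j m hm
        apply eq_zero_of_isCompl (IsSupermodule.isCompl 𝓡 (𝓜 := 𝓡))
        · rcases zmod_two_cases j with rfl | rfl
          · exact e0
          · exact e1
        · rcases zmod_two_cases j with rfl | rfl
          · exact e1
          · exact e0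
      rw [AddSubgroup.mem_bot]
      apply Subtype.ext
      ext m
      rw [← M.proj_add m, map_add, hz 0 _ (M.proj_mem 0 m), hz 1 _ (M.proj_mem 1 m)]
      simp
    · rw [codisjoint_iff_le_sup]
      intro ψ _
      have h : (⟨dualProjFun M 0 ψ.1, dualProjFun_mem M 0 ψ.2⟩ : dualSubmodule M) +
          ⟨dualProjFun M 1 ψ.1, dualProjFun_mem M 1 ψ.2⟩ = ψ := by
        apply Subtype.ext
        ext m
        have hh (j : ZMod 2) (m : M.carrier) (hm : m ∈ M.gr j) :
            (dualProjFun M 0 ψ.1 + dualProjFun M 1 ψ.1) m = ψ.1 m := by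
          rw [AddMonoidHom.add_apply, dualProjFun_homogeneous M 0 _ hm,
            dualProjFun_homogeneous M 1 _ hm]
          have := rproj_add 𝓡 (ψ.1 m)
          rcases zmod_two_cases j with rfl | rfl
          · exact this
          · exact (add_comm _ _).trans this
        change (dualProjFun M 0 ψ.1 + dualProjFun M 1 ψ.1) m = ψ.1 m
        rw [← M.proj_add m, map_add, map_add, hh 0 _ (M.proj_mem 0 m), hh 1 _ (M.proj_mem 1 m)]
      rw [← h]
      refine AddSubgroup.add_mem_sup ?_ ?_
      · intro j m hm
        have := rproj_mem 𝓡 (0 + j) (ψ.1 m)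
        rw [← dualProjFun_homogeneous M 0 _ hm] at this
        exact this
      · intro j m hm
        have := rproj_mem 𝓡 (1 + j) (ψ.1 m)
        rw [← dualProjFun_homogeneous M 1 _ hm] at this
        exact this
  smul_mem := by
    intro i k r ψ hr hψ j m hm
    rw [add_assoc]
    exact SetLike.mul_mem_graded hr (hψ j m hm)

/-- The dual supermodule `Mᵛ` of `M`. -/
abbrev dual : SuperModule 𝓡 where
  carrier := dualSubmodule M
  gr := dualGr M

end Dual

variable [SuperCommutative 𝓡]

/-- `M` is invertible: it is generated by finitely many homogeneous elements, and
`M_𝔭 ≃ R_𝔭` as `R_𝔭`-supermodules for every prime ideal `𝔭`, where the subscript denotes the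
localization at the multiplicative set `R₀ \ 𝔭₀`. -/
def IsInvertible (M : SuperModule 𝓡) : Prop :=
  (∃ t : Finset M.carrier, (∀ m ∈ t, m ∈ M.gr 0 ∨ m ∈ M.gr 1) ∧
    Submodule.span R (t : Set M.carrier) = ⊤) ∧
  ∀ (p : Ideal R) [p.IsTwoSided] [p.IsPrime],
    ∃ e : M.carrier[(evenPart 𝓡 p.primeCompl)⁻¹] ≃ₗ[R[(evenPart 𝓡 p.primeCompl)⁻¹]]
        R[(evenPart 𝓡 p.primeCompl)⁻¹],
      ∀ i, ∀ x ∈ locGr 𝓡 M.gr p.primeCompl i, e x ∈ locGr 𝓡 𝓡 p.primeCompl i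

end SuperModule

section Groups

variable {R : Type u} [Ring R] (𝓡 : ZMod 2 → AddSubgroup R) [GradedRing 𝓡] [SuperCommutative 𝓡]

/-- Isomorphism of invertible supermodules. -/
def picSetoid : Setoid {M : SuperModule 𝓡 // M.IsInvertible} where
  r M N := M.1.Isomorphic N.1
  iseqv := ⟨fun M => .refl M.1, fun h => h.symm, fun h h' => h.trans h'⟩

/-- The set `Pic₊(R)` of isomorphism classes of invertible `R`-supermodules. -/
def Pic : Type (u + 1) := Quotient (picSetoid 𝓡)

variable {𝓡}

/-- The class `[M]` of an invertible supermodule `M`. -/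
def Pic.mk (M : SuperModule 𝓡) (hM : M.IsInvertible) : Pic 𝓡 := Quotient.mk (picSetoid 𝓡) ⟨M, hM⟩

/-- `N` is a `ℤ/2`-graded submodule of `K(R)`, that is `N = (N ∩ K(R)₀) ⊕ (N ∩ K(R)₁)`. -/
def IsGradedSubmodule (N : Submodule R (TotalFractions 𝓡)) : Prop :=
  ∀ x ∈ N, ∃ a ∈ N, ∃ b ∈ N, a ∈ fracGr 𝓡 0 ∧ b ∈ fracGr 𝓡 1 ∧ a + b = x

/-- The components `N ∩ K(R)ᵢ` of a submodule `N` of `K(R)`. -/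
def subGr (N : Submodule R (TotalFractions 𝓡)) (i : ZMod 2) : AddSubgroup N :=
  (fracGr 𝓡 i).comap N.subtype.toAddMonoidHom

theorem subGr_isSupermodule {N : Submodule R (TotalFractions 𝓡)} (hN : IsGradedSubmodule N) :
    IsSupermodule 𝓡 (subGr N) where
  isCompl := by
    constructor
    · rw [disjoint_iff_inf_le]
      rintro x ⟨h0, h1⟩
      rw [AddSubgroup.mem_bot]
      exact Subtype.ext (eq_zero_of_isCompl (locGr_isCompl 𝓡 𝓡 _) h0 h1)
    · rw [codisjoint_iff_le_sup]
      rintro ⟨x, hx⟩ _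
      obtain ⟨a, ha, b, hb, ha0, hb1, rfl⟩ := hN x hx
      exact AddSubgroup.add_mem_sup (x := (⟨a, ha⟩ : N)) (y := ⟨b, hb⟩) ha0 hb1
  smul_mem := by
    intro i j r m hr hm
    exact (locGr_isSupermodule 𝓡 𝓡 (nonZeroDivisors R)).smul_mem hr hm

/-- An `R`-subsupermodule of `K(R)`, as a supermodule. -/
abbrev subSuperModule (N : Submodule R (TotalFractions 𝓡)) (hN : IsGradedSubmodule N) :
    SuperModule 𝓡 :=
  letI := subGr_isSupermodule hN
  { carrier := N, gr := subGr N }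

variable (𝓡) in
/-- The set `Cart(R)` of invertible `R`-subsupermodules of `K(R)`. -/
structure Cart : Type u where
  submodule : Submodule R (TotalFractions 𝓡)
  isGraded : IsGradedSubmodule submodule
  isInvertible : (subSuperModule submodule isGraded).IsInvertible

/-- An element of `Cart(R)`, as a supermodule. -/
abbrev Cart.toSuperModule (N : Cart 𝓡) : SuperModule 𝓡 := subSuperModule N.submodule N.isGraded

/-- `N⁻¹`: the `R`-submodule of `K(R)` generated by the homogeneous `d` with `d N ⊆ R`. Here
`1 : Submodule R K(R)` is the image of `R` in `K(R)`. -/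
def fracInv (N : Submodule R (TotalFractions 𝓡)) : Submodule R (TotalFractions 𝓡) :=
  Submodule.span R {d | (d ∈ fracGr 𝓡 0 ∨ d ∈ fracGr 𝓡 1) ∧
    ∀ x ∈ N, d * x ∈ (1 : Submodule R (TotalFractions 𝓡))}

variable (𝓡) in
/-- The group of units of the even part `K(R)₀` of `K(R)`. -/
def evenUnits : Subgroup (TotalFractions 𝓡)ˣ where
  carrier := {u | (u : TotalFractions 𝓡) ∈ fracGr 𝓡 0 ∧
    ((u⁻¹ : (TotalFractions 𝓡)ˣ) : TotalFractions 𝓡) ∈ fracGr 𝓡 0}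
  one_mem' := by
    have h : (1 : TotalFractions 𝓡) ∈ fracGr 𝓡 0 :=
      ⟨1, SetLike.one_mem_graded 𝓡, 1, OreLocalization.one_def⟩
    exact ⟨h, by simpa using h⟩
  inv_mem' := fun h => ⟨h.2, by simpa using h.1⟩
  mul_mem' := by
    have h {x y : TotalFractions 𝓡} (hx : x ∈ fracGr 𝓡 0) (hy : y ∈ fracGr 𝓡 0) :
        x * y ∈ fracGr 𝓡 0 := by
      obtain ⟨a, ha, s, rfl⟩ := hx
      obtain ⟨b, hb, t, rfl⟩ := hy
      refine ⟨a * b, by simpa using SetLike.mul_mem_graded ha hb, t * s, ?_⟩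
      exact OreLocalization.oreDiv_mul_char a b s t a t (even_comm 𝓡 t.2.2 a)
    intro u v hu hv
    refine ⟨h hu.1 hv.1, ?_⟩
    rw [mul_inv_rev]
    exact h hv.2 hu.2

end Groups

/-! Everything rests on replacing the local definition of invertibility by a global one. A local
generator of `M` is an even `m` with an even functional `F` such that `F(x) m = F(m) x`; where
`F(m)` is invertible, `M` is free on `m`. A supermodule is invertible exactly when finitely many
local generators satisfy `∑ Fᵢ(mᵢ) = 1` (`IsInvertible.hasPartition`, `HasPartition.isInvertible`).
One direction clears denominators in `M_𝔭 ≃ R_𝔭`; this is possible because `R₀` is Noetherian and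
`R` is a finite `R₀`-module. The values `F(m)` then generate the unit ideal of `R₀`: as 2 is
regular, odd elements square to zero, so every prime of `R₀` lies under a prime of `R`, and there
some `F(m)` is not in it.

With a partition of unity, stability under duals and tensor products is formal, and evaluation is an
isomorphism `Mᵛ ⊗ M ≃ R`. The key identity is `HasPartition.apply_smul`, the rank-one law `F(x) y =
F(y) x` for even `y`.

The link with `K(R)` is `HasPartition.exists_regular`: gluing local generators at the finitely many
maximal associated primes of `R` over `R₀` gives one whose value `F(m)` is a non-zerodivisor. Its
functional embeds `M` in `K(R)`, so every class comes from a submodule. For a submodule `N` of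
`K(R)` its element `m` is a unit of `K(R)₀`, so functionals on `N` are multiplications by fractions,
and the partition becomes `∑ dᵢ mᵢ = 1` with `dᵢ N ⊆ R`. Hence `N⁻¹ N = R`, and invertible
submodules form a group.

Finally `M ⊗ N ≃ M N` for invertible submodules (`Cart.tensor_isomorphic`). The group laws of Pic
are therefore transported from Cart along a surjection, with no associators to construct. A
submodule isomorphic to `R` is generated by the image of 1, an even unit, which gives the kernel. -/

namespace SuperModule

/-! ### The even part and its prime ideals -/

set_option linter.unusedSectionVars false

variable {R : Type u} [Ring R] (𝓡 : ZMod 2 → AddSubgroup R) [GradedRing 𝓡]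

/-- The even part of a superring, as a subring. -/
def evenSubring : Subring R where
  __ := 𝓡 0
  one_mem' := SetLike.one_mem_graded 𝓡
  mul_mem' := fun {a b} ha hb => by simpa using SetLike.mul_mem_graded (A := 𝓡) ha hb

theorem even_mul_mem {a b : R} (ha : a ∈ 𝓡 0) {i : ZMod 2} (hb : b ∈ 𝓡 i) : a * b ∈ 𝓡 i := by
  simpa using SetLike.mul_mem_graded ha hb

theorem even_smul_mem (M : SuperModule 𝓡) {a : R} {m : M.carrier} {i : ZMod 2} (ha : a ∈ 𝓡 0)
    (hm : m ∈ M.gr i) : a • m ∈ M.gr i := by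
  simpa using IsSupermodule.smul_mem (𝓡 := 𝓡) ha hm

theorem smul_even_mem (M : SuperModule 𝓡) {a : R} {m : M.carrier} {i : ZMod 2} (ha : a ∈ 𝓡 i)
    (hm : m ∈ M.gr 0) : a • m ∈ M.gr i := by
  simpa using IsSupermodule.smul_mem (𝓡 := 𝓡) ha hm

theorem odd_mul_odd_mem {x y : R} (hx : x ∈ 𝓡 1) (hy : y ∈ 𝓡 1) : x * y ∈ 𝓡 0 :=
  SetLike.mul_mem_graded (A := 𝓡) hx hy

theorem rproj_mul_zero (x y : R) :
    rproj 𝓡 0 (x * y) = rproj 𝓡 0 x * rproj 𝓡 0 y + rproj 𝓡 1 x * rproj 𝓡 1 y :=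
  proj_smul (SuperModule.self 𝓡) x y 0

variable [SuperCommutative 𝓡]

instance evenSubringCommRing : CommRing (evenSubring 𝓡) where
  __ := (evenSubring 𝓡).toRing
  mul_comm := fun a b => Subtype.ext (even_comm 𝓡 a.2 b)

theorem odd_anticomm {x y : R} (hx : x ∈ 𝓡 1) (hy : y ∈ 𝓡 1) : x * y = -(y * x) := by
  simpa using SuperCommutative.comm (𝓡 := 𝓡) hx hy

variable {𝓡} in
theorem odd_sq (h2 : (2 : R) ∈ nonZeroDivisors R) {x : R} (hx : x ∈ 𝓡 1) : x * x = 0 := by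
  have h := odd_anticomm 𝓡 hx hx
  have : 2 * (x * x) = 0 := by
    rw [two_mul]
    nth_rewrite 1 [h]
    exact neg_add_cancel _
  exact (mem_nonZeroDivisors_iff.1 h2).1 _ this

/-- The evenness projection, as a map to the even subring. -/
noncomputable def evenComponent (x : R) : evenSubring 𝓡 := ⟨rproj 𝓡 0 x, rproj_mem 𝓡 0 x⟩

/-- Anticommuting the inner factors turns `(xy)²` into `-x²y²`, which vanishes because odd squares
do. So `xy` is nilpotent in `R₀` and lies in every prime. -/
theorem odd_mul_odd_mem_prime (h2 : (2 : R) ∈ nonZeroDivisors R) (Q : Ideal (evenSubring 𝓡))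
    [Q.IsPrime] {x y : R} (hx : x ∈ 𝓡 1) (hy : y ∈ 𝓡 1) :
    (⟨x * y, odd_mul_odd_mem 𝓡 hx hy⟩ : evenSubring 𝓡) ∈ Q := by
  have h : (⟨x * y, odd_mul_odd_mem 𝓡 hx hy⟩ : evenSubring 𝓡) * ⟨x * y, odd_mul_odd_mem 𝓡 hx hy⟩
      = 0 := by
    apply Subtype.ext
    change x * y * (x * y) = 0
    rw [mul_assoc, ← mul_assoc y x y, odd_anticomm 𝓡 hy hx, neg_mul, mul_assoc, odd_sq h2 hy]
    simp
  have := Ideal.IsPrime.mem_or_mem_of_mul_eq_zero ‹Q.IsPrime› h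
  tauto

/-- Every prime ideal of the even part is the even part of a prime ideal containing all odd
elements. -/
theorem exists_prime_lying_over (h2 : (2 : R) ∈ nonZeroDivisors R) (Q : Ideal (evenSubring 𝓡))
    [hQ : Q.IsPrime] : ∃ p : Ideal R, p.IsTwoSided ∧ p.IsPrime ∧
      ∀ a : evenSubring 𝓡, (a : R) ∈ p ↔ a ∈ Q := by
  -- Products of odd elements lie in `Q`, so the even projection is multiplicative modulo `Q`. The
  -- required prime is the kernel of the resulting ring map from `R` to the domain `R₀/Q`.
  have hmul (x y : R) : evenComponent 𝓡 (x * y) - evenComponent 𝓡 x * evenComponent 𝓡 y ∈ Q := by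
    have := odd_mul_odd_mem_prime 𝓡 h2 Q (rproj_mem 𝓡 1 x) (rproj_mem 𝓡 1 y)
    convert this using 1
    apply Subtype.ext
    change rproj 𝓡 0 (x * y) - rproj 𝓡 0 x * rproj 𝓡 0 y = _
    rw [rproj_mul_zero, add_sub_cancel_left]
  have hmem (x y : R) : evenComponent 𝓡 (x * y) ∈ Q ↔
      evenComponent 𝓡 x * evenComponent 𝓡 y ∈ Q := by
    constructor
    · intro h
      simpa using sub_mem h (hmul x y)
    · intro h
      simpa using add_mem (hmul x y) h
  have heven (a : evenSubring 𝓡) : evenComponent 𝓡 a = a := Subtype.ext (rproj_same 𝓡 a.2)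
  refine ⟨⟨⟨⟨Set.ofPred fun x => evenComponent 𝓡 x ∈ Q, ?_⟩, ?_⟩, ?_⟩, ⟨?_⟩, ⟨?_, ?_⟩, ?_⟩
  · intro x y hx hy
    have : evenComponent 𝓡 (x + y) = evenComponent 𝓡 x + evenComponent 𝓡 y :=
      Subtype.ext (map_add _ _ _)
    change evenComponent 𝓡 (x + y) ∈ Q
    rw [this]
    exact add_mem hx hy
  · have : evenComponent 𝓡 0 = 0 := Subtype.ext (map_zero _)
    change evenComponent 𝓡 0 ∈ Q
    rw [this]
    exact zero_mem Q
  · intro c x hx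
    exact (hmem c x).2 (Q.mul_mem_left _ hx)
  · intro x y hx
    exact (hmem x y).2 (Q.mul_mem_right _ hx)
  · rw [Ideal.ne_top_iff_one]
    change ¬ evenComponent 𝓡 1 ∈ Q
    have := heven 1
    rw [OneMemClass.coe_one] at this
    rw [this]
    exact (Ideal.ne_top_iff_one _).1 hQ.ne_top
  · intro x y h
    exact hQ.mem_or_mem ((hmem x y).1 h)
  · intro a
    change evenComponent 𝓡 a ∈ Q ↔ _
    rw [heven]

/-! ### Finiteness over the even part -/

section Noetherian

/-- A component of `R`, as a submodule over the even part. -/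
def componentSubmodule (i : ZMod 2) : Submodule (evenSubring 𝓡) R where
  __ := 𝓡 i
  smul_mem' := fun a _ hx => even_mul_mem 𝓡 a.2 hx

/-- The ideal `RL` has components `L` (since `R₁R₁L ⊆ L`) and `R₁L`. The second conjunct is what
keeps the induction going: multiplication by an odd scalar brings the other component back into
degree `i`. -/
theorem rproj_mem_of_mem_span {i : ZMod 2} {L : Submodule (evenSubring 𝓡) R}
    (hL : L ≤ componentSubmodule 𝓡 i) {x : R} (hx : x ∈ Submodule.span R (L : Set R)) :
    rproj 𝓡 i x ∈ L ∧ ∀ b ∈ 𝓡 1, b * rproj 𝓡 (i + 1) x ∈ L := by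
  have e : i + 1 + 1 = i := by
    clear hL hx
    revert i
    decide
  induction hx using Submodule.span_induction with
  | mem x h => exact ⟨by rwa [rproj_same 𝓡 (hL h)], fun b _ => by simp [rproj_other 𝓡 (hL h)]⟩
  | zero => simp
  | add x y _ _ hx hy =>
    simp only [map_add, mul_add]
    exact ⟨add_mem hx.1 hy.1, fun b hb => add_mem (hx.2 b hb) (hy.2 b hb)⟩
  | smul a x _ h =>
    have key (k : ZMod 2) : rproj 𝓡 k (a • x) = rproj 𝓡 0 a * rproj 𝓡 k x +
        rproj 𝓡 1 a * rproj 𝓡 (k + 1) x := proj_smul (SuperModule.self 𝓡) a x k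
    refine ⟨?_, fun b hb => ?_⟩
    · rw [key]
      exact add_mem (L.smul_mem ⟨_, rproj_mem 𝓡 0 a⟩ h.1) (h.2 _ (rproj_mem 𝓡 1 a))
    · rw [key, mul_add, e, ← mul_assoc, ← mul_assoc, ← even_comm 𝓡 (rproj_mem 𝓡 0 a) b, mul_assoc]
      exact add_mem (L.smul_mem ⟨_, rproj_mem 𝓡 0 a⟩ (h.2 b hb))
        (L.smul_mem ⟨_, odd_mul_odd_mem 𝓡 hb (rproj_mem 𝓡 1 a)⟩ h.1)

variable {𝓡} in
-- An `R₀`-submodule `L` of `Rᵢ` is recovered from the superideal `RL` as its degree `i` component.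
-- So `L ↦ RL` is strictly increasing, and the chain condition pulls back.
theorem isNoetherian_component (hR : NoetherianSuperring 𝓡) (i : ZMod 2) :
    IsNoetherian (evenSubring 𝓡) (componentSubmodule 𝓡 i) := by
  have hle (L : Submodule (evenSubring 𝓡) (componentSubmodule 𝓡 i)) :
      L.map (componentSubmodule 𝓡 i).subtype ≤ componentSubmodule 𝓡 i :=
    Submodule.map_subtype_le _ _
  let f (L : Submodule (evenSubring 𝓡) (componentSubmodule 𝓡 i)) : HomogeneousIdeal 𝓡 :=
    ⟨Ideal.span (L.map (componentSubmodule 𝓡 i).subtype),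
      Ideal.homogeneous_span 𝓡 _ fun x hx => ⟨i, hle L hx⟩⟩
  have hf (L L') (h : f L ≤ f L') : L ≤ L' := by
    intro x hx
    have h1 : (x : R) ∈ (f L').toIdeal := h (Ideal.subset_span ⟨x, hx, rfl⟩)
    have h2 := (rproj_mem_of_mem_span 𝓡 (hle L') h1).1
    rw [rproj_same 𝓡 x.2] at h2
    obtain ⟨y, hy, hxy⟩ := h2
    rwa [← Subtype.ext hxy]
  have hmono (L L') (h : L ≤ L') : f L ≤ f L' :=
    Ideal.span_mono (Submodule.map_mono h)
  have : StrictMono f := fun L L' h => lt_of_le_not_ge (hmono _ _ h.le) fun h' =>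
    h.not_ge (hf _ _ h')
  rw [isNoetherian_iff']
  have := hR
  unfold NoetherianSuperring at this
  exact StrictMono.wellFoundedGT ‹StrictMono f›

variable {𝓡} in
theorem isNoetherian_even (hR : NoetherianSuperring 𝓡) : IsNoetherian (evenSubring 𝓡) R := by
  have := isNoetherian_component hR 0
  have := isNoetherian_component hR 1
  have h : componentSubmodule 𝓡 0 ⊔ componentSubmodule 𝓡 1 = ⊤ := by
    rw [eq_top_iff]
    intro x _
    rw [← rproj_add 𝓡 x]
    exact Submodule.add_mem_sup (rproj_mem 𝓡 0 x) (rproj_mem 𝓡 1 x)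
  have h' : IsNoetherian (evenSubring 𝓡) (⊤ : Submodule (evenSubring 𝓡) R) := by
    rw [← h]
    infer_instance
  exact isNoetherian_of_linearEquiv Submodule.topEquiv

variable {𝓡} in
theorem isNoetherianRing_even (hR : NoetherianSuperring 𝓡) : IsNoetherianRing (evenSubring 𝓡) :=
  isNoetherian_component hR 0

variable {𝓡} in
/-- The even elements outside finitely many pairwise incomparable primes are regular. -/
theorem exists_finset_primes (hR : NoetherianSuperring 𝓡) :
    ∃ T : Finset (Ideal (evenSubring 𝓡)), (∀ P ∈ T, P.IsPrime) ∧
      (∀ P ∈ T, ∀ P' ∈ T, P ≤ P' → P = P') ∧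
      ∀ a : evenSubring 𝓡, (∀ P ∈ T, a ∉ P) → (a : R) ∈ nonZeroDivisors R := by
  classical
  have := isNoetherian_even hR
  have := isNoetherianRing_even hR
  have hfin := associatedPrimes.finite (evenSubring 𝓡) R
  -- Zero divisors on the `R₀`-module `R` form the union of its finitely many associated primes.
  -- Keeping only the maximal ones loses nothing and makes the primes incomparable.
  refine ⟨hfin.toFinset.filter fun P => Maximal (· ∈ hfin.toFinset) P, ?_, ?_, ?_⟩
  · intro P hP
    rw [Finset.mem_filter, Set.Finite.mem_toFinset] at hP
    exact hP.1.isPrime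
  · intro P hP P' hP' h
    rw [Finset.mem_filter] at hP hP'
    exact le_antisymm h (hP.2.2 hP'.1 h)
  · intro a ha
    have hreg (x : R) (hx : (a : R) * x = 0) : x = 0 := by
      by_contra hne
      have : a ∈ ⋃ p ∈ associatedPrimes (evenSubring 𝓡) R, (p : Set (evenSubring 𝓡)) := by
        rw [biUnion_associatedPrimes_eq_zero_divisors]
        exact ⟨x, hne, hx⟩
      simp only [Set.mem_iUnion] at this
      obtain ⟨P, hP, haP⟩ := this
      obtain ⟨P', hPP', hP'⟩ := hfin.toFinset.exists_le_maximal (hfin.mem_toFinset.2 hP)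
      exact ha P' (Finset.mem_filter.2 ⟨hP'.1, hP'⟩) (hPP' haP)
    exact mem_nonZeroDivisors_iff.2 ⟨hreg, fun x hx => hreg x (by rwa [even_comm 𝓡 a.2])⟩

end Noetherian

end SuperModule

/-! ### Local generators and partitions of unity -/

namespace SuperModule

set_option linter.unusedSectionVars false

variable {R : Type u} [Ring R] {𝓡 : ZMod 2 → AddSubgroup R} [GradedRing 𝓡]

/-- An even element `m` and an even functional `F` with `F(x) m = F(m) x` for all `x`; they
trivialize the supermodule wherever `F(m)` is invertible. -/
structure LocalGenerator (M : SuperModule 𝓡) where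
  elt : M.carrier
  elt_mem : elt ∈ M.gr 0
  func : M.carrier →ₗ[R] R
  func_mem : ∀ {i : ZMod 2} {x : M.carrier}, x ∈ M.gr i → func x ∈ 𝓡 i
  func_smul : ∀ x, func x • elt = func elt • x

/-- Local generators that form a partition of unity. -/
def HasPartition (M : SuperModule 𝓡) : Prop :=
  ∃ (ι : Type) (_ : Fintype ι) (P : ι → M.LocalGenerator), ∑ i, (P i).func (P i).elt = 1

variable [SuperCommutative 𝓡]

/-- Multiplication by an even element, as a linear map. -/
def evenMul (a : R) (ha : a ∈ 𝓡 0) : R →ₗ[R] R where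
  toFun x := a * x
  map_add' := mul_add a
  map_smul' r x := by
    simp only [smul_eq_mul, RingHom.id_apply]
    rw [← mul_assoc, even_comm 𝓡 ha, mul_assoc]

theorem even_smul_comm (M : SuperModule 𝓡) {a : R} (ha : a ∈ 𝓡 0) (b : R) (x : M.carrier) :
    a • b • x = b • a • x := by
  rw [smul_smul, smul_smul, even_comm 𝓡 ha]

/-- Multiplying the functional of a local generator by an even element. -/
def LocalGenerator.smul {M : SuperModule 𝓡} (P : M.LocalGenerator) (a : R) (ha : a ∈ 𝓡 0) :
    M.LocalGenerator where
  elt := P.elt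
  elt_mem := P.elt_mem
  func := (evenMul a ha).comp P.func
  func_mem := fun hx => even_mul_mem 𝓡 ha (P.func_mem hx)
  func_smul := fun x => by
    change (a * P.func x) • P.elt = (a * P.func P.elt) • x
    rw [mul_smul, P.func_smul, mul_smul]

/-! ### Clearing denominators -/

section Localize

variable {M : Type u} [AddCommGroup M] [Module R M] (T : Submonoid R)

theorem oreDiv_one_eq_zero {m : M} : (m /ₒ (1 : evenPart 𝓡 T)) = 0 ↔
    ∃ s ∈ evenPart 𝓡 T, s • m = 0 := by
  rw [OreLocalization.zero_def, OreLocalization.oreDiv_eq_iff]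
  constructor
  · rintro ⟨u, v, h1, h2⟩
    refine ⟨u, u.2, ?_⟩
    have : (u : R) = v := by simpa using h2
    rw [this, ← h1, smul_zero]
  · rintro ⟨s, hs, h⟩
    exact ⟨⟨s, hs⟩, s, by simp [h], by simp⟩

theorem oreDiv_one_eq {m n : M} (h : (m /ₒ (1 : evenPart 𝓡 T)) = n /ₒ 1) :
    ∃ s ∈ evenPart 𝓡 T, s • m = s • n := by
  have : (m - n) /ₒ (1 : evenPart 𝓡 T) = 0 := by
    rw [sub_eq_add_neg, ← OreLocalization.add_oreDiv, h, OreLocalization.add_oreDiv,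
      add_neg_cancel, OreLocalization.zero_oreDiv]
  obtain ⟨s, hs, h⟩ := (oreDiv_one_eq_zero T).1 this
  exact ⟨s, hs, by rwa [smul_sub, sub_eq_zero] at h⟩

theorem smul_oreDiv_self (m : M) (s : evenPart 𝓡 T) : (s : R) • (m /ₒ s) = m /ₒ 1 := by
  rw [← OreLocalization.oreDiv_one_smul, OreLocalization.smul_cancel]

theorem smul_eq_oreDiv_mul (r : R) (x : R[(evenPart 𝓡 T)⁻¹]) : r • x = (r /ₒ 1) * x := by
  rw [← OreLocalization.oreDiv_one_smul, smul_eq_mul]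

theorem loc_smul_add (r : R) (x y : R[(evenPart 𝓡 T)⁻¹]) : r • (x + y) = r • x + r • y := by
  simp only [smul_eq_oreDiv_mul, mul_add]

theorem loc_smul_zero (r : R) : r • (0 : R[(evenPart 𝓡 T)⁻¹]) = 0 := by
  rw [smul_eq_oreDiv_mul, mul_zero]

theorem smul_left_cancel {x y : M[(evenPart 𝓡 T)⁻¹]} {s : R} (hs : s ∈ evenPart 𝓡 T)
    (h : s • x = s • y) : x = y := by
  have := congrArg (fun z => ((1 : R) /ₒ (⟨s, hs⟩ : evenPart 𝓡 T)) • z) h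
  simp only [← OreLocalization.oreDiv_one_smul, smul_smul] at this
  have e : ((1 : R) /ₒ (⟨s, hs⟩ : evenPart 𝓡 T)) * (s /ₒ 1) = 1 := by
    rw [OreLocalization.mul_div_one, one_mul]
    exact OreLocalization.div_eq_one' hs
  simpa only [e, one_smul] using this

theorem even_smul_comm_loc {a : R} (ha : a ∈ 𝓡 0) (b : R) (x : M[(evenPart 𝓡 T)⁻¹]) :
    a • b • x = b • a • x := by
  rw [smul_smul, smul_smul, even_comm 𝓡 ha]

/-- The product of the finitely many individual witnesses works: `mono` allows extra factors on the
left, and even elements commute, so each witness can be moved to the right. -/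
theorem exists_common {α : Type*} (t : Finset α) (C : R → α → Prop)
    (mono : ∀ s ∈ evenPart 𝓡 T, ∀ s' ∈ evenPart 𝓡 T, ∀ x, C s x → C (s' * s) x)
    (h : ∀ x ∈ t, ∃ s ∈ evenPart 𝓡 T, C s x) : ∃ s ∈ evenPart 𝓡 T, ∀ x ∈ t, C s x := by
  classical
  induction t using Finset.induction_on with
  | empty => exact ⟨1, one_mem _, by simp⟩
  | insert a t _ ih =>
    obtain ⟨s, hs, h1⟩ := ih fun x hx => h x (Finset.mem_insert_of_mem hx)
    obtain ⟨s', hs', h2⟩ := h a (Finset.mem_insert_self a t)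
    refine ⟨s * s', mul_mem hs hs', fun x hx => ?_⟩
    rcases Finset.mem_insert.1 hx with rfl | hx
    · exact mono _ hs' _ hs _ h2
    · rw [even_comm 𝓡 hs.2]
      exact mono _ hs _ hs' _ (h1 x hx)

/-- One denominator annihilates the kernel of `R → S⁻¹R`. -/
theorem exists_annihilator (hR : NoetherianSuperring 𝓡) :
    ∃ u ∈ evenPart 𝓡 T, ∀ r : R, (r /ₒ (1 : evenPart 𝓡 T)) = 0 → u * r = 0 := by
  have := isNoetherian_even hR
  -- The kernel is an `R₀`-submodule of a Noetherian module. A denominator killing its generators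
  -- kills all of it, being central.
  let N : Submodule (evenSubring 𝓡) R :=
    { carrier := Set.ofPred fun r => (r /ₒ (1 : evenPart 𝓡 T)) = 0
      zero_mem' := OreLocalization.zero_oreDiv _
      add_mem' := fun {a b} ha hb => by
        change (a + b) /ₒ (1 : evenPart 𝓡 T) = 0
        rw [← OreLocalization.add_oreDiv, show a /ₒ (1 : evenPart 𝓡 T) = 0 from ha,
          show b /ₒ (1 : evenPart 𝓡 T) = 0 from hb, add_zero]
      smul_mem' := fun c r hr => by
        change ((c : R) • r) /ₒ (1 : evenPart 𝓡 T) = 0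
        rw [← OreLocalization.smul_oreDiv_one, show r /ₒ (1 : evenPart 𝓡 T) = 0 from hr,
          loc_smul_zero] }
  obtain ⟨t, ht⟩ := IsNoetherian.noetherian N
  obtain ⟨u, hu, h⟩ := exists_common T t (fun s r => s * r = 0)
    (fun s _ s' _ x h => by rw [mul_assoc, h, mul_zero]) fun x hx =>
      (oreDiv_one_eq_zero T).1 (show x ∈ N from ht ▸ Submodule.subset_span hx)
  refine ⟨u, hu, fun r hr => ?_⟩
  replace hr : r ∈ Submodule.span (evenSubring 𝓡) (t : Set R) := by
    rw [ht]; exact hr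
  clear * - hr h hu
  induction hr using Submodule.span_induction with
  | mem x hx => exact h x hx
  | zero => exact mul_zero u
  | add x y _ _ hx hy => rw [mul_add, hx, hy, add_zero]
  | smul a x _ hx =>
    change u * (a * x) = 0
    rw [← mul_assoc, even_comm 𝓡 hu.2, mul_assoc, hx, mul_zero]

end Localize

/-! ### Invertibility as a partition of unity -/

/-- An invertible supermodule has a local generator at every prime. -/
theorem IsInvertible.exists_localGenerator (hR : NoetherianSuperring 𝓡) {M : SuperModule 𝓡}
    (hM : M.IsInvertible) (p : Ideal R) [p.IsTwoSided] [p.IsPrime] :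
    ∃ P : M.LocalGenerator, P.func P.elt ∉ p := by
  obtain ⟨⟨t, ht, hspan⟩, hloc⟩ := hM
  obtain ⟨e, he⟩ := hloc p
  have esmul (r : R) (x : M.carrier[(evenPart 𝓡 p.primeCompl)⁻¹]) : e (r • x) = r • e x := by
    rw [← OreLocalization.oreDiv_one_smul, map_smul, OreLocalization.oreDiv_one_smul]
  have hone : (1 : R[(evenPart 𝓡 p.primeCompl)⁻¹]) ∈ locGr 𝓡 𝓡 p.primeCompl 0 :=
    ⟨1, SetLike.one_mem_graded 𝓡, 1, OreLocalization.one_def⟩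
  -- The even generator comes from the numerator of the preimage `m / s₀` of 1.
  obtain ⟨m, hm, s₀, hms⟩ := mem_of_equiv (locGr_isCompl 𝓡 M.gr p.primeCompl)
    (locGr_isCompl 𝓡 𝓡 p.primeCompl) e.toAddEquiv he 0 1 hone
  have hem : e (m /ₒ 1) = (s₀ : R) /ₒ 1 := by
    rw [← smul_oreDiv_self p.primeCompl m s₀, esmul, ← hms]
    change (s₀ : R) • e (e.symm 1) = _
    rw [e.apply_symm_apply, ← OreLocalization.oreDiv_one_smul, smul_eq_mul, mul_one]
  obtain ⟨u, hu, hker⟩ := exists_annihilator p.primeCompl hR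
  -- Finite generation of `M` gives one `s` such that `s e` takes `M` into the image of `R`.
  have hden : ∃ s ∈ evenPart 𝓡 p.primeCompl, ∀ x : M.carrier, ∃ r : R,
      s • e (x /ₒ 1) = r /ₒ 1 := by
    obtain ⟨s, hs, h⟩ := exists_common p.primeCompl t (fun s x => ∃ r : R, s • e (x /ₒ 1) = r /ₒ 1)
      (fun s _ s' _ x ⟨r, h⟩ => ⟨s' • r, by
        rw [mul_smul, h, OreLocalization.smul_oreDiv_one]⟩) fun x _ => by
        obtain ⟨r, s, h⟩ : ∃ r s, e (x /ₒ 1) = r /ₒ s := by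
          generalize e (x /ₒ 1) = y
          induction y with | _ r s
          exact ⟨r, s, rfl⟩
        exact ⟨s, s.2, r, by rw [h, smul_oreDiv_self]⟩
    refine ⟨s, hs, fun x => ?_⟩
    have hx : x ∈ Submodule.span R (t : Set M.carrier) := by rw [hspan]; trivial
    induction hx using Submodule.span_induction with
    | mem x hx => exact h x hx
    | zero => exact ⟨0, by simp [loc_smul_zero]⟩
    | add x y _ _ hx hy =>
      obtain ⟨a, ha⟩ := hx
      obtain ⟨b, hb⟩ := hy
      exact ⟨a + b, by
        rw [← OreLocalization.add_oreDiv, map_add, loc_smul_add, ha, hb, OreLocalization.add_oreDiv]⟩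
    | smul c x _ hx =>
      obtain ⟨a, ha⟩ := hx
      exact ⟨c • a, by
        rw [← OreLocalization.smul_oreDiv_one, esmul, even_smul_comm_loc _ hs.2, ha,
          OreLocalization.smul_oreDiv_one]⟩
  obtain ⟨s, hs, hden⟩ := hden
  choose ρ hρ using hden
  have hker' (a b : R) (h : (a /ₒ (1 : evenPart 𝓡 p.primeCompl)) = b /ₒ 1) : u * a = u * b := by
    rw [← sub_eq_zero, ← mul_sub]
    apply hker
    rw [sub_eq_add_neg, ← OreLocalization.add_oreDiv, h, OreLocalization.add_oreDiv,
      add_neg_cancel, OreLocalization.zero_oreDiv]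
  -- The lift `ρ` is a mere choice, but `u` kills the kernel of `R → R_𝔭`. Hence `u ρ(x)` depends
  -- only on the image of `ρ(x)`, and `F` is linear.
  let F : M.carrier →ₗ[R] R :=
    { toFun := fun x => u * ρ x
      map_add' := fun x y => by
        rw [← mul_add]
        apply hker'
        rw [← hρ, ← OreLocalization.add_oreDiv, map_add, loc_smul_add, hρ, hρ,
          OreLocalization.add_oreDiv]
      map_smul' := fun c x => by
        have : u * ρ (c • x) = u * (c • ρ x) := by
          apply hker'
          rw [← hρ, ← OreLocalization.smul_oreDiv_one, ← OreLocalization.smul_oreDiv_one, esmul,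
            even_smul_comm_loc _ hs.2, hρ]
        rw [this, smul_eq_mul, ← mul_assoc, even_comm 𝓡 hu.2, mul_assoc]
        rfl }
  have hF (x : M.carrier) : (F x /ₒ (1 : evenPart 𝓡 p.primeCompl)) = (u * s) • e (x /ₒ 1) := by
    rw [mul_smul, hρ, OreLocalization.smul_oreDiv_one]
    rfl
  have hFmem {i : ZMod 2} {x : M.carrier} (hx : x ∈ M.gr i) : F x ∈ 𝓡 i := by
    have h1 : e (x /ₒ 1) ∈ locGr 𝓡 𝓡 p.primeCompl i := he i _ ⟨x, hx, 1, rfl⟩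
    have h2 : ρ x /ₒ 1 ∈ locGr 𝓡 𝓡 p.primeCompl i := by
      rw [← hρ, ← zero_add i]
      exact IsSupermodule.smul_mem (𝓡 := 𝓡) hs.2 h1
    have h3 (k) : rproj 𝓡 k (ρ x) /ₒ 1 ∈ locGr 𝓡 𝓡 p.primeCompl k := ⟨_, rproj_mem 𝓡 k _, 1, rfl⟩
    have h4 : rproj 𝓡 i (ρ x) + rproj 𝓡 (i + 1) (ρ x) = ρ x := by
      rcases zmod_two_cases i with rfl | rfl
      · exact rproj_add 𝓡 _
      · rw [add_comm]; exact rproj_add 𝓡 _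
    -- The component of the wrong parity dies in `R_𝔭`, so `u` annihilates it.
    have h5 : rproj 𝓡 (i + 1) (ρ x) /ₒ (1 : evenPart 𝓡 p.primeCompl) = 0 := by
      have h6 : rproj 𝓡 (i + 1) (ρ x) /ₒ 1 ∈ locGr 𝓡 𝓡 p.primeCompl i := by
        have := sub_mem h2 (h3 i)
        have h7 : ρ x /ₒ (1 : evenPart 𝓡 p.primeCompl) =
            rproj 𝓡 i (ρ x) /ₒ 1 + rproj 𝓡 (i + 1) (ρ x) /ₒ 1 := by
          rw [OreLocalization.add_oreDiv, h4]
        rwa [h7, add_sub_cancel_left] at this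
      rcases zmod_two_cases i with rfl | rfl
      · exact eq_zero_of_isCompl (locGr_isCompl 𝓡 𝓡 p.primeCompl) h6 (h3 _)
      · exact eq_zero_of_isCompl (locGr_isCompl 𝓡 𝓡 p.primeCompl) (h3 _) h6
    change u * ρ x ∈ 𝓡 i
    rw [← h4, mul_add, hker _ h5, add_zero]
    exact even_mul_mem 𝓡 hu.2 (rproj_mem 𝓡 i _)
  have hFm : (F m /ₒ (1 : evenPart 𝓡 p.primeCompl)) = (u * s * s₀) /ₒ 1 := by
    rw [hF, hem, OreLocalization.smul_oreDiv_one, smul_eq_mul]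
  -- The identity `F(x) m = F(m) x` holds in `M_𝔭`, where `e` sends both sides to `s₀ F(x)`. A
  -- single `v` makes it hold for the generators, hence on all of `M`, and is then absorbed into the
  -- functional.
  have hkill (x : M.carrier) : ∃ v ∈ evenPart 𝓡 p.primeCompl, v • F x • m = v • F m • x := by
    apply oreDiv_one_eq
    apply e.injective
    have h1 : e ((F x • m) /ₒ 1) = (s₀ : R) • (F x /ₒ 1) := by
      rw [← OreLocalization.smul_oreDiv_one, esmul, hem, OreLocalization.smul_oreDiv_one,
        OreLocalization.smul_oreDiv_one, smul_eq_mul, smul_eq_mul, even_comm 𝓡 s₀.2.2]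
    rw [h1, hF, ← OreLocalization.smul_oreDiv_one, esmul, ← OreLocalization.oreDiv_one_smul (F m),
      hFm, OreLocalization.oreDiv_one_smul, smul_smul, even_comm 𝓡 s₀.2.2]
  obtain ⟨v, hv, hkill'⟩ := exists_common p.primeCompl t
    (fun v x => v • F x • m = v • F m • x)
    (fun s _ s' _ x h => by rw [mul_smul, h, mul_smul]) fun x _ => hkill x
  have hkill'' (x : M.carrier) : v • F x • m = v • F m • x := by
    have hx : x ∈ Submodule.span R (t : Set M.carrier) := by rw [hspan]; trivial
    induction hx using Submodule.span_induction with
    | mem x hx => exact hkill' x hx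
    | zero => simp
    | add x y _ _ hx hy => rw [map_add, add_smul, smul_add, hx, hy, smul_add, smul_add]
    | smul c x _ hx =>
      rw [map_smul, smul_eq_mul, mul_smul, even_smul_comm M hv.2, hx,
        even_smul_comm M (hFmem hm) c, even_smul_comm M hv.2 c]
  refine ⟨⟨m, hm, (evenMul v hv.2).comp F, fun hx => even_mul_mem 𝓡 hv.2 (hFmem hx), fun x => ?_⟩, ?_⟩
  · change (v * F x) • m = (v * F m) • x
    rw [mul_smul, hkill'', mul_smul]
  · change v * F m ∉ p
    intro h
    -- Up to the factor `w` the value `F(m)` is `u s s₀`, a product of elements outside `𝔭`.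
    obtain ⟨w, hw, hwF⟩ := oreDiv_one_eq _ hFm
    have hFp : F m ∈ p := (Ideal.IsPrime.mem_or_mem ‹_› h).resolve_left hv.1
    have h' : w • (u * s * s₀) ∈ p := hwF ▸ p.smul_mem w hFp
    exact mul_mem hw.1 (mul_mem (mul_mem hu.1 hs.1) s₀.2.1) h'

/-- If the values `F(m)` did not generate the unit ideal of `R₀`, they would lie in a maximal ideal,
hence in a prime of `R` above it, contradicting the local generator at that prime. The even
coefficients of the resulting relation are absorbed into the functionals. -/
theorem IsInvertible.hasPartition (h2 : (2 : R) ∈ nonZeroDivisors R) (hR : NoetherianSuperring 𝓡)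
    {M : SuperModule 𝓡} (hM : M.IsInvertible) : M.HasPartition := by
  classical
  let I : Ideal (evenSubring 𝓡) := Ideal.span
    (Set.range fun P : M.LocalGenerator => ⟨P.func P.elt, P.func_mem P.elt_mem⟩)
  have hI : I = ⊤ := by
    by_contra hne
    obtain ⟨Q, hQ, hIQ⟩ := I.exists_le_maximal hne
    obtain ⟨p, _, _, hp⟩ := exists_prime_lying_over 𝓡 h2 Q
    obtain ⟨P, hP⟩ := hM.exists_localGenerator hR p
    exact hP ((hp ⟨P.func P.elt, P.func_mem P.elt_mem⟩).2 (hIQ (Ideal.subset_span ⟨P, rfl⟩)))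
  obtain ⟨n, c, g, hg⟩ := Submodule.mem_span_set'.1 (show (1 : evenSubring 𝓡) ∈ I by rw [hI]; trivial)
  choose P hP using fun i => (g i).2
  refine ⟨Fin n, inferInstance, fun i => (P i).smul (c i) (c i).2, ?_⟩
  have := congrArg (evenSubring 𝓡).subtype hg
  rw [map_sum, map_one] at this
  rw [← this]
  refine Finset.sum_congr rfl fun i _ => ?_
  rw [← hP i]
  rfl

/-- The pairs `(mᵢ, Fᵢ)` thus form a dual basis, so an element killed by all `Fᵢ` is zero. -/
theorem LocalGenerator.sum_smul {M : SuperModule 𝓡} {ι : Type} [Fintype ι]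
    {P : ι → M.LocalGenerator} (hP : ∑ i, (P i).func (P i).elt = 1) (x : M.carrier) :
    ∑ i, (P i).func x • (P i).elt = x := by
  simp_rw [LocalGenerator.func_smul]
  rw [← Finset.sum_smul, hP, one_smul]

/-- Some value `c = F(m)` is outside `𝔭`, as their sum is 1. Over `R_𝔭` the map `r ↦ r m` then has
inverse `x ↦ F(x) / c`. -/
theorem HasPartition.isInvertible {M : SuperModule 𝓡} (hM : M.HasPartition) : M.IsInvertible := by
  classical
  obtain ⟨ι, _, P, hP⟩ := hM
  refine ⟨⟨Finset.univ.image fun i => (P i).elt, ?_, ?_⟩, ?_⟩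
  · intro m hm
    obtain ⟨i, _, rfl⟩ := Finset.mem_image.1 hm
    exact .inl (P i).elt_mem
  · rw [eq_top_iff]
    intro x _
    rw [← LocalGenerator.sum_smul hP x]
    exact sum_mem fun i _ => Submodule.smul_mem _ _ (Submodule.subset_span (by simp))
  · intro p _ _
    obtain ⟨i, hi⟩ : ∃ i, (P i).func (P i).elt ∉ p := by
      by_contra! h
      exact (Ideal.ne_top_iff_one p).1 (Ideal.IsPrime.ne_top ‹_›) (hP ▸ sum_mem fun i _ => h i)
    set Q := P i
    have hs : Q.func Q.elt ∈ evenPart 𝓡 p.primeCompl := ⟨hi, Q.func_mem Q.elt_mem⟩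
    let f := LinearMap.toSpanSingleton R[(evenPart 𝓡 p.primeCompl)⁻¹]
      M.carrier[(evenPart 𝓡 p.primeCompl)⁻¹] (Q.elt /ₒ 1)
    have hf (r : R) (s) : f (r /ₒ s) = (r • Q.elt) /ₒ s := by
      rw [LinearMap.toSpanSingleton_apply, OreLocalization.smul_div_one]
    have hbij : Function.Bijective f := by
      constructor
      · rw [injective_iff_map_eq_zero]
        intro a ha
        induction a with | _ r s
        rw [hf] at ha
        have h1 := congrArg (fun z => (s : R) • z) ha
        simp only [smul_oreDiv_self, smul_zero] at h1
        obtain ⟨v, hv, hvr⟩ := (oreDiv_one_eq_zero _).1 h1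
        have h2 := congrArg Q.func hvr
        rw [map_smul, map_smul, map_zero, smul_eq_mul, smul_eq_mul,
          ← even_comm 𝓡 hs.2, ← mul_assoc, even_comm 𝓡 hv.2, mul_assoc] at h2
        apply smul_left_cancel _ s.2
        rw [smul_oreDiv_self, smul_zero, oreDiv_one_eq_zero]
        exact ⟨_, mul_mem hs hv, by rwa [smul_eq_mul, mul_assoc]⟩
      · intro x
        induction x with | _ m s
        refine ⟨Q.func m /ₒ (⟨_, hs⟩ * s), ?_⟩
        rw [hf, Q.func_smul]
        exact (OreLocalization.expand' m s ⟨_, hs⟩).symm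
    refine ⟨(LinearEquiv.ofBijective f hbij).symm, ?_⟩
    refine mem_of_equiv (locGr_isCompl 𝓡 𝓡 p.primeCompl) (locGr_isCompl 𝓡 M.gr p.primeCompl)
      (LinearEquiv.ofBijective f hbij).toAddEquiv ?_
    rintro k _ ⟨r, hr, s, rfl⟩
    refine ⟨r • Q.elt, smul_even_mem 𝓡 M hr Q.elt_mem, s, ?_⟩
    exact hf r s

end SuperModule

/-! ### The rank-one law and regular generators -/

namespace SuperModule

set_option linter.unusedSectionVars false

variable {R : Type u} [Ring R] {𝓡 : ZMod 2 → AddSubgroup R} [GradedRing 𝓡] [SuperCommutative 𝓡]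

/-- Elements of `R₀` with sum 1 have squares generating the unit ideal, so the annihilator of `z` in
`R₀` is everything. This permits checking identities after multiplying twice by a local value. -/
theorem LocalGenerator.eq_zero_of_sq_smul {M : SuperModule 𝓡} {ι : Type} [Fintype ι]
    {P : ι → M.LocalGenerator} (hP : ∑ i, (P i).func (P i).elt = 1) {z : M.carrier}
    (hz : ∀ i, (P i).func (P i).elt • (P i).func (P i).elt • z = 0) : z = 0 := by
  let c (i : ι) : evenSubring 𝓡 := ⟨(P i).func (P i).elt, (P i).func_mem (P i).elt_mem⟩
  have hc : ∑ i, c i = 1 := by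
    apply Subtype.ext
    rw [AddSubmonoidClass.coe_finsetSum]
    exact hP
  let I := LinearMap.ker (LinearMap.toSpanSingleton (evenSubring 𝓡) M.carrier z)
  have hI : I = ⊤ := by
    by_contra hne
    obtain ⟨Q, hQ, hIQ⟩ := Ideal.exists_le_maximal I hne
    have hcQ (i) : c i ∈ Q := by
      have : c i * c i ∈ Q := hIQ (by
        change (c i * c i) • z = 0
        rw [mul_smul]
        exact hz i)
      have := hQ.isPrime.mem_or_mem this
      tauto
    exact (Ideal.ne_top_iff_one Q).1 hQ.ne_top (hc ▸ sum_mem fun i _ => hcQ i)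
  have : (1 : evenSubring 𝓡) ∈ I := by rw [hI]; trivial
  simpa [I] using this

/-- Locally `x` and `y` are multiples of one generator: with `c = Q(m)` one has `c x = Q(x) m` and
`c y = Q(y) m`. Hence `c² F(x) y = Q(x) F(m) Q(y) m`, which is symmetric in `x` and `y` because
`Q(y)` and `F(m)` are even, hence central. -/
theorem HasPartition.apply_smul {M : SuperModule 𝓡} (hM : M.HasPartition) (F : M.carrier →ₗ[R] R)
    (hF : ∀ x ∈ M.gr 0, F x ∈ 𝓡 0) {y : M.carrier} (hy : y ∈ M.gr 0) (x : M.carrier) :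
    F x • y = F y • x := by
  obtain ⟨ι, _, P, hP⟩ := hM
  rw [← sub_eq_zero]
  refine LocalGenerator.eq_zero_of_sq_smul hP fun i => ?_
  set Q := P i
  have hc : Q.func Q.elt ∈ 𝓡 0 := Q.func_mem Q.elt_mem
  have hFy : F y ∈ 𝓡 0 := hF y hy
  have hQy : Q.func y ∈ 𝓡 0 := Q.func_mem hy
  have hFQ : F Q.elt ∈ 𝓡 0 := hF _ Q.elt_mem
  have key (u v : M.carrier) : Q.func Q.elt • Q.func Q.elt • F u • v =
      (Q.func u * F Q.elt * Q.func v) • Q.elt := by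
    rw [even_smul_comm M hc (F u) v, smul_smul (Q.func Q.elt) (F u), ← smul_eq_mul, ← map_smul,
      ← Q.func_smul, ← Q.func_smul, map_smul, smul_eq_mul, smul_smul]
  rw [smul_sub, smul_sub, key, key, sub_eq_zero]
  congr 1
  rw [← even_comm 𝓡 hQy, mul_assoc (Q.func y), even_comm 𝓡 hFQ]

theorem regular_smul_eq_zero {M : SuperModule 𝓡} (hM : M.HasPartition) {s : R}
    (hs : s ∈ nonZeroDivisors R) {x : M.carrier} (h : s • x = 0) : x = 0 := by
  obtain ⟨ι, _, P, hP⟩ := hM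
  rw [← LocalGenerator.sum_smul hP x]
  refine Finset.sum_eq_zero fun i _ => ?_
  have := congrArg (P i).func h
  rw [map_smul, map_zero, smul_eq_mul] at this
  rw [(mem_nonZeroDivisors_iff.1 hs).1 _ this, zero_smul]

theorem sum_notMem {A : Type*} [CommRing A] {T : Finset (Ideal A)} (f : T → A) (Q : T)
    (h : ∀ P, P ≠ Q → f P ∈ Q.1) (hQ : f Q ∉ Q.1) : ∑ P, f P ∉ Q.1 := by
  classical
  rw [← Finset.add_sum_erase _ _ (Finset.mem_univ Q)]
  intro hmem
  refine hQ ((Ideal.add_mem_iff_left _ (sum_mem fun P hP => h P ?_)).1 hmem)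
  exact (Finset.mem_erase.1 hP).1

/-- The product of elements chosen in each `P ≠ Q` outside `Q`; incomparability provides them and
primality of `Q` keeps the product outside. -/
theorem exists_separating {A : Type*} [CommRing A] {T : Finset (Ideal A)}
    (hT : ∀ P ∈ T, P.IsPrime) (hinc : ∀ P ∈ T, ∀ P' ∈ T, P ≤ P' → P = P') (Q : T) :
    ∃ a, a ∉ Q.1 ∧ ∀ P : T, P ≠ Q → a ∈ P.1 := by
  classical
  have : ∀ P : T, ∃ b, b ∉ Q.1 ∧ (P ≠ Q → b ∈ P.1) := by
    intro P
    by_cases h : P = Q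
    · exact ⟨1, (Ideal.ne_top_iff_one _).1 (hT _ Q.2).ne_top, fun h' => absurd h h'⟩
    · have : ¬ P.1 ≤ Q.1 := fun hle => h (Subtype.ext (hinc _ P.2 _ Q.2 hle))
      obtain ⟨b, hb, hb'⟩ := Set.not_subset.1 this
      exact ⟨b, hb', fun _ => hb⟩
  choose b hb hb' using this
  have := hT _ Q.2
  refine ⟨∏ P, b P, ?_, fun P hP => ?_⟩
  · rw [Ideal.IsPrime.prod_mem_iff]
    rintro ⟨P, _, h⟩
    exact hb P h
  · exact Ideal.mem_of_dvd _ (Finset.dvd_prod_of_mem b (Finset.mem_univ P)) (hb' P hP)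

/-- Over the total fractions, an invertible supermodule becomes free. -/
theorem HasPartition.exists_regular (hR : NoetherianSuperring 𝓡) {M : SuperModule 𝓡}
    (hM : M.HasPartition) : ∃ P : M.LocalGenerator, P.func P.elt ∈ evenPart 𝓡 (nonZeroDivisors R) := by
  classical
  obtain ⟨T, hT, hinc, hreg⟩ := exists_finset_primes hR
  have hgen (Q : T) : ∃ P : M.LocalGenerator,
      (⟨P.func P.elt, P.func_mem P.elt_mem⟩ : evenSubring 𝓡) ∉ Q.1 := by
    obtain ⟨ι, _, P, hP⟩ := hM
    by_contra! h
    refine (Ideal.ne_top_iff_one Q.1).1 (hT _ Q.2).ne_top ?_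
    have := sum_mem (t := Finset.univ) fun i _ => h (P i)
    convert this using 1
    apply Subtype.ext
    rw [AddSubmonoidClass.coe_finsetSum]
    exact hP.symm
  choose G hG using hgen
  choose a ha ha' using exists_separating hT hinc
  -- Modulo `Q` only the `Q`-term of this sum matters, so `G_Q(m) ≡ a_Q G_Q(m_Q)`, which is nonzero.
  -- Gluing the functionals in the same way gives `F(m) ≡ a_Q G_Q(m)`. So `F(m)` avoids all the
  -- primes in `T` and is regular.
  let m : M.carrier := ∑ P, (a P : R) • (G P).elt
  have hm : m ∈ M.gr 0 := sum_mem fun P _ => even_smul_mem 𝓡 M (a P).2 (G P).elt_mem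
  have hGm (Q : T) : (⟨(G Q).func m, (G Q).func_mem hm⟩ : evenSubring 𝓡) ∉ Q.1 := by
    have := sum_notMem (fun P => a P * ⟨(G Q).func (G P).elt, (G Q).func_mem (G P).elt_mem⟩) Q
      (fun P hP => Q.1.mul_mem_right _ (ha' P Q hP.symm))
      ((hT _ Q.2).mul_notMem (ha Q) (hG Q))
    convert this using 2
    apply Subtype.ext
    rw [AddSubmonoidClass.coe_finsetSum]
    simp only [m, map_sum, map_smul]
    rfl
  let F : M.carrier →ₗ[R] R := ∑ P, (evenMul (a P : R) (a P).2).comp (G P).func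
  have hF (x) : F x = ∑ P, (a P : R) * (G P).func x := by
    simp only [F, LinearMap.sum_apply]
    rfl
  have hFmem {i : ZMod 2} {x : M.carrier} (hx : x ∈ M.gr i) : F x ∈ 𝓡 i := by
    rw [hF]
    exact sum_mem fun P _ => even_mul_mem 𝓡 (a P).2 ((G P).func_mem hx)
  have hFm (Q : T) : (⟨F m, hFmem hm⟩ : evenSubring 𝓡) ∉ Q.1 := by
    have := sum_notMem (fun P => a P * ⟨(G P).func m, (G P).func_mem hm⟩) Q
      (fun P hP => Q.1.mul_mem_right _ (ha' P Q hP.symm))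
      ((hT _ Q.2).mul_notMem (ha Q) (hGm Q))
    convert this using 2
    apply Subtype.ext
    rw [AddSubmonoidClass.coe_finsetSum]
    exact hF m
  refine ⟨⟨m, hm, F, hFmem, hM.apply_smul F (fun x hx => hFmem hx) hm⟩, ?_, hFmem hm⟩
  exact hreg ⟨F m, hFmem hm⟩ fun P hP => hFm ⟨P, hP⟩

theorem hasPartition_self : (SuperModule.self 𝓡).HasPartition := by
  refine ⟨Unit, inferInstance, fun _ => ⟨1, SetLike.one_mem_graded 𝓡, LinearMap.id,
    fun h => h, fun x => ?_⟩, by simp⟩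
  change x * 1 = 1 * x
  rw [mul_one, one_mul]

theorem HasPartition.of_isomorphic {M N : SuperModule 𝓡} (hM : M.HasPartition)
    (h : M.Isomorphic N) : N.HasPartition := by
  obtain ⟨ι, _, P, hP⟩ := hM
  have hs := h
  obtain ⟨e, he⟩ := h
  have he' := mem_of_equiv (IsSupermodule.isCompl 𝓡) (IsSupermodule.isCompl 𝓡) e.toAddEquiv he
  refine ⟨ι, inferInstance, fun i => ⟨e (P i).elt, he 0 _ (P i).elt_mem,
    (P i).func.comp e.symm.toLinearMap, fun {k x} hx => (P i).func_mem (he' k x hx), fun x => ?_⟩, ?_⟩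
  · change (P i).func (e.symm x) • e (P i).elt = (P i).func (e.symm (e (P i).elt)) • x
    rw [e.symm_apply_apply, ← map_smul, (P i).func_smul, map_smul, e.apply_symm_apply]
  · simpa using hP

/-! ### Duals -/

section Dual

theorem dual_apply_even {M : SuperModule 𝓡} (ψ : dualSubmodule M) {m : M.carrier}
    (hm : m ∈ M.gr 0) (r : R) : ψ.1 (r • m) = ψ.1 m * r := by
  have h0 := ψ.2 0 0 _ m (rproj_mem 𝓡 0 r) hm
  have h1 := ψ.2 1 0 _ m (rproj_mem 𝓡 1 r) hm
  simp only [mul_zero, uzpow_zero, one_smul] at h0 h1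
  conv_lhs => rw [← rproj_add 𝓡 r, add_smul, map_add, h0, h1, ← mul_add, rproj_add]

theorem dual_even_smul {M : SuperModule 𝓡} (ψ : dualSubmodule M) (m : M.carrier)
    {r : R} (hr : r ∈ 𝓡 0) : ψ.1 (r • m) = r * ψ.1 m := by
  have h0 := ψ.2 0 0 r _ hr (M.proj_mem 0 m)
  have h1 := ψ.2 0 1 r _ hr (M.proj_mem 1 m)
  simp only [zero_mul, uzpow_zero, one_smul] at h0 h1
  conv_lhs => rw [← M.proj_add m, smul_add, map_add, h0, h1, ← add_mul, ← map_add, M.proj_add,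
    ← even_comm 𝓡 hr]

/-- The local generator of the dual given by evaluation. -/
def LocalGenerator.dual {M : SuperModule 𝓡} (P : M.LocalGenerator) : M.dual.LocalGenerator where
  elt := ⟨P.func.toAddMonoidHom, fun i j r m hr hm => by
    change P.func (((-1 : ℤˣ) ^ (i * j)) • (r • m)) = P.func m * r
    rw [Units.smul_def, map_zsmul, map_smul, smul_eq_mul, mul_comm i j,
      SuperCommutative.comm (P.func_mem hm) hr, Units.smul_def]⟩
  elt_mem := fun j m hm => by
    rw [zero_add]
    exact P.func_mem hm
  func :=
    { toFun := fun ψ => ψ.1 P.elt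
      map_add' := fun _ _ => rfl
      map_smul' := fun _ _ => rfl }
  func_mem := fun {i ψ} hψ => by simpa using hψ 0 _ P.elt_mem
  func_smul := fun ψ => by
    apply Subtype.ext
    ext x
    -- With `m` the generator and `F` its functional: `ψ(m) F(x) = ψ(F(x) m) = ψ(F(m) x) = F(m)
    -- ψ(x)`, where `m` and `F(m)` are even, so no sign appears.
    change ψ.1 P.elt * P.func x = P.func P.elt * ψ.1 x
    rw [← dual_apply_even ψ P.elt_mem, P.func_smul,
      dual_even_smul ψ x (P.func_mem P.elt_mem)]

theorem HasPartition.dual {M : SuperModule 𝓡} (hM : M.HasPartition) : M.dual.HasPartition := by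
  obtain ⟨ι, _, P, hP⟩ := hM
  exact ⟨ι, inferInstance, fun i => (P i).dual, hP⟩

end Dual

/-! ### Tensor products and evaluation -/

section Tensor

variable (M N : SuperModule 𝓡)

/-- The pure tensor `m ⊗ n`. -/
def tmk (m : M.carrier) (n : N.carrier) : (M.tensor N).carrier :=
  (tensorRelSubmodule M N).mkQ (m ⊗ₜ[ℤ] n)

theorem smul_tmk (r : R) (m : M.carrier) (n : N.carrier) :
    r • tmk M N m n = tmk M N (r • m) n := by
  rw [tmk, ← map_smul, TensorProduct.smul_tmul', tmk]

theorem tmk_add_left (m m' : M.carrier) (n : N.carrier) :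
    tmk M N (m + m') n = tmk M N m n + tmk M N m' n := by
  rw [tmk, TensorProduct.add_tmul, map_add, tmk, tmk]

theorem tmk_add_right (m : M.carrier) (n n' : N.carrier) :
    tmk M N m (n + n') = tmk M N m n + tmk M N m n' := by
  rw [tmk, TensorProduct.tmul_add, map_add, tmk, tmk]

theorem tmk_balanced {i j : ZMod 2} {r : R} {m : M.carrier} (hr : r ∈ 𝓡 i) (hm : m ∈ M.gr j)
    (n : N.carrier) : tmk M N (((-1 : ℤˣ) ^ (i * j)) • (r • m)) n = tmk M N m (r • n) :=
  (Submodule.Quotient.eq _).2 (Submodule.subset_span ⟨i, j, r, m, n, hr, hm, rfl⟩)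

theorem tmk_smul_of_even_left (r : R) {m : M.carrier} (hm : m ∈ M.gr 0) (n : N.carrier) :
    tmk M N m (r • n) = tmk M N (r • m) n := by
  have h0 := tmk_balanced M N (rproj_mem 𝓡 0 r) hm n
  have h1 := tmk_balanced M N (rproj_mem 𝓡 1 r) hm n
  simp only [mul_zero, uzpow_zero, one_smul] at h0 h1
  rw [← rproj_add 𝓡 r, add_smul, add_smul, tmk_add_left, tmk_add_right, h0, h1]

theorem tmk_even_smul {r : R} (hr : r ∈ 𝓡 0) (m : M.carrier) (n : N.carrier) :
    tmk M N m (r • n) = tmk M N (r • m) n := by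
  have h0 := tmk_balanced M N hr (M.proj_mem 0 m) n
  have h1 := tmk_balanced M N hr (M.proj_mem 1 m) n
  simp only [zero_mul, uzpow_zero, one_smul] at h0 h1
  rw [← M.proj_add m, smul_add, tmk_add_left, tmk_add_left, h0, h1]

variable {M N} in
theorem tensor_induction {C : (M.tensor N).carrier → Prop} (h0 : C 0)
    (hadd : ∀ x y, C x → C y → C (x + y)) (h : ∀ m n, C (tmk M N m n)) (y) : C y := by
  obtain ⟨y, rfl⟩ := Submodule.mkQ_surjective _ y
  induction y with
  | zero => simpa using h0
  | add x y hx hy => rw [map_add]; exact hadd _ _ hx hy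
  | tmul m n => exact h m n

variable {L : Type u} [AddCommGroup L] [Module R L]

variable {M N} in
/-- The linear map on `M ⊗ N` induced by a balanced biadditive map. -/
noncomputable def tensorLift (β : M.carrier →+ N.carrier →+ L)
    (hsmul : ∀ (r : R) m n, β (r • m) n = r • β m n)
    (hbal : ∀ (i j : ZMod 2) (r : R) (m : M.carrier) (n : N.carrier), r ∈ 𝓡 i → m ∈ M.gr j →
      ((-1 : ℤˣ) ^ (i * j)) • r • β m n = β m (r • n)) :
    (M.tensor N).carrier →ₗ[R] L :=
  (tensorRelSubmodule M N).liftQ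
    { toFun := TensorProduct.liftAddHom β fun (k : ℤ) m n => by simp
      map_add' := map_add _
      map_smul' := fun r x => by
        induction x with
        | zero => simp
        | add x y hx hy => rw [smul_add, map_add, hx, hy, map_add, smul_add]
        | tmul m n =>
          rw [TensorProduct.smul_tmul', TensorProduct.liftAddHom_tmul, hsmul,
            TensorProduct.liftAddHom_tmul]
          rfl }
    (by
      rw [tensorRelSubmodule, Submodule.span_le]
      rintro _ ⟨i, j, r, m, n, hr, hm, rfl⟩
      rw [SetLike.mem_coe, LinearMap.mem_ker, map_sub, sub_eq_zero]
      rw [LinearMap.coe_mk, AddHom.coe_mk, TensorProduct.liftAddHom_tmul, TensorProduct.liftAddHom_tmul, ← hbal i j r m n hr hm,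
        Units.smul_def, map_zsmul, Units.smul_def, ← hsmul]
      rfl)

variable (β : M.carrier →+ N.carrier →+ L)
    (hsmul : ∀ (r : R) (m : M.carrier) (n : N.carrier), β (r • m) n = r • β m n)
    (hbal : ∀ (i j : ZMod 2) (r : R) (m : M.carrier) (n : N.carrier), r ∈ 𝓡 i → m ∈ M.gr j →
      ((-1 : ℤˣ) ^ (i * j)) • r • β m n = β m (r • n))

theorem tensorLift_tmk (m : M.carrier) (n : N.carrier) :
    tensorLift β hsmul hbal (tmk M N m n) = β m n := rfl

theorem tensorLift_mem (G : ZMod 2 → AddSubgroup L)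
    (hβ : ∀ i j m n, m ∈ M.gr i → n ∈ N.gr j → β m n ∈ G (i + j)) {k : ZMod 2}
    {y : (M.tensor N).carrier} (hy : y ∈ (M.tensor N).gr k) : tensorLift β hsmul hbal y ∈ G k := by
  obtain ⟨y, hy, rfl⟩ := hy
  change tensorLift β hsmul hbal ((tensorRelSubmodule M N).mkQ y) ∈ G k
  induction hy using AddSubgroup.closure_induction with
  | mem x hx =>
    obtain ⟨i, j, m, n, hm, hn, rfl, rfl⟩ := hx
    exact hβ i j m n hm hn
  | zero => simp
  | add x y _ _ hx hy => rw [map_add, map_add]; exact add_mem hx hy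
  | neg x _ hx => rw [map_neg, map_neg]; exact neg_mem hx

/-- The biadditive map `(m, n) ↦ F(m) G(n)`. -/
def mulBiadditive {K : Type u} [Ring K] (F : M.carrier →+ K) (G : N.carrier →+ K) :
    M.carrier →+ N.carrier →+ K :=
  AddMonoidHom.mk' (fun m => (AddMonoidHom.mulLeft (F m)).comp G) fun m m' => by
    ext n
    simp [add_mul]

variable {M N} in
/-- The local generator of a tensor product. -/
noncomputable def LocalGenerator.tensor (P : M.LocalGenerator) (Q : N.LocalGenerator) :
    (M.tensor N).LocalGenerator where
  elt := tmk M N P.elt Q.elt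
  elt_mem := ⟨_, by simpa using tmul_mem_tensorIntGr M N P.elt_mem Q.elt_mem, rfl⟩
  func := tensorLift (mulBiadditive M N P.func.toAddMonoidHom Q.func.toAddMonoidHom)
    (fun r m n => by
      change P.func (r • m) * Q.func n = r * (P.func m * Q.func n)
      rw [map_smul, smul_eq_mul, mul_assoc])
    (fun i j r m n hr hm => by
      change _ • (r * (P.func m * Q.func n)) = P.func m * Q.func (r • n)
      rw [map_smul, smul_eq_mul, ← mul_assoc, ← mul_assoc, mul_comm i j,
        SuperCommutative.comm (P.func_mem hm) hr, smul_mul_assoc])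
  func_mem := fun hy => tensorLift_mem M N _ _ _ 𝓡
    (fun _ _ _ _ hm hn => SetLike.mul_mem_graded (P.func_mem hm) (Q.func_mem hn)) hy
  func_smul := fun y => by
    induction y using tensor_induction with
    | h0 => simp
    | hadd x y hx hy => rw [map_add, add_smul, hx, hy, smul_add]
    | h m n =>
      rw [tensorLift_tmk, tensorLift_tmk]
      change (P.func m * Q.func n) • _ = (P.func P.elt * Q.func Q.elt) • _
      -- `Q(n)` crosses to the right factor without sign because the left generator is even;
      -- `Q(Q.elt)` comes back without sign because it is even itself.
      rw [mul_smul, mul_smul, smul_tmk, ← tmk_smul_of_even_left M N _ P.elt_mem, Q.func_smul,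
        smul_tmk, P.func_smul, ← smul_tmk, tmk_even_smul M N (Q.func_mem Q.elt_mem),
        smul_tmk M N (Q.func Q.elt)]

variable {M N} in
theorem LocalGenerator.tensor_func_tmk (P : M.LocalGenerator) (Q : N.LocalGenerator) (m n) :
    (P.tensor Q).func (tmk M N m n) = P.func m * Q.func n := rfl

variable {M N} in
theorem HasPartition.tensor (hM : M.HasPartition) (hN : N.HasPartition) :
    (M.tensor N).HasPartition := by
  obtain ⟨ι, _, P, hP⟩ := hM
  obtain ⟨κ, _, Q, hQ⟩ := hN
  refine ⟨ι × κ, inferInstance, fun x => (P x.1).tensor (Q x.2), ?_⟩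
  rw [Fintype.sum_prod_type]
  change ∑ i, ∑ j, (P i).func (P i).elt * (Q j).func (Q j).elt = 1
  rw [← Finset.sum_mul_sum, hP, hQ, mul_one]

/-- Evaluation identifies `Mᵛ ⊗ M` with `R`. -/
theorem HasPartition.dual_tensor_isomorphic (hM : M.HasPartition) :
    (M.dual.tensor M).Isomorphic (SuperModule.self 𝓡) := by
  let β : M.dual.carrier →+ M.carrier →+ R :=
    (dualSubmodule M).subtype.toAddMonoidHom
  have hbal (i j : ZMod 2) (r : R) (ψ : M.dual.carrier) (x : M.carrier) (hr : r ∈ 𝓡 i)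
      (hψ : ψ ∈ M.dual.gr j) : ((-1 : ℤˣ) ^ (i * j)) • r • β ψ x = β ψ (r • x) := by
    have main (k : ZMod 2) (x : M.carrier) (hx : x ∈ M.gr k) :
        ((-1 : ℤˣ) ^ (i * j)) • r • ψ.1 x = ψ.1 (r • x) := by
      have h1 := ψ.2 i k r x hr hx
      rw [SuperCommutative.comm (hψ k x hx) hr] at h1
      -- Right linearity carries the sign `(-1)^(ik)`, and commuting `ψ(x)`, of parity `j + k`, past
      -- `r` carries `(-1)^(i(j+k))`; what remains is `(-1)^(ij)`.
      rcases zmod_two_cases i with rfl | rfl <;> rcases zmod_two_cases j with rfl | rfl <;>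
        rcases zmod_two_cases k with rfl | rfl <;> simp_all [show (1 : ZMod 2) + 1 = 0 by decide]
      exact neg_eq_iff_eq_neg.1 h1.symm.symm |>.symm
    change _ • r • ψ.1 x = ψ.1 (r • x)
    rw [← M.proj_add x, map_add, smul_add, smul_add, smul_add, map_add, main 0 _ (M.proj_mem 0 x),
      main 1 _ (M.proj_mem 1 x)]
  let f := tensorLift β (fun _ _ _ => rfl) hbal
  have hf (ψ : M.dual.carrier) (x : M.carrier) : f (tmk M.dual M ψ x) = ψ.1 x := rfl
  have hM' := hM
  obtain ⟨ι, _, P, hP⟩ := hM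
  refine ⟨LinearEquiv.ofBijective f ⟨?_, ?_⟩, fun i y hy =>
    tensorLift_mem M.dual M β (fun _ _ _ => rfl) hbal 𝓡 (fun i j ψ x hψ hx => hψ j x hx) hy⟩
  · rw [injective_iff_map_eq_zero]
    intro y hy
    -- By the rank-one law every functional of the tensor partition is a multiple of evaluation. So
    -- if evaluation kills `y`, they all do, and the dual basis gives `y = 0`.
    have key (i j : ι) (y) : ((P i).dual.tensor (P j)).func y = (P j).func (P i).elt * f y := by
      induction y using tensor_induction with
      | h0 => simp
      | hadd x y hx hy => rw [map_add, map_add, hx, hy, mul_add]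
      | h ψ x =>
        rw [LocalGenerator.tensor_func_tmk, hf]
        change ψ.1 (P i).elt * (P j).func x = _
        rw [← dual_apply_even ψ (P i).elt_mem,
          hM'.apply_smul (P j).func (fun x hx => (P j).func_mem hx) (P i).elt_mem,
          dual_even_smul ψ x ((P j).func_mem (P i).elt_mem)]
    have hsum : ∑ x : ι × ι, (((P x.1).dual.tensor (P x.2)).func
        ((P x.1).dual.tensor (P x.2)).elt) = 1 := by
      rw [Fintype.sum_prod_type]
      change ∑ i, ∑ j, (P i).func (P i).elt * (P j).func (P j).elt = 1
      rw [← Finset.sum_mul_sum, hP, mul_one]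
    rw [← LocalGenerator.sum_smul hsum y]
    refine Finset.sum_eq_zero fun x _ => ?_
    rw [key, hy, mul_zero, zero_smul]
  · intro r
    -- The element `∑ Fᵢ ⊗ mᵢ` evaluates to `∑ Fᵢ(mᵢ) = 1`.
    refine ⟨r • ∑ i, tmk M.dual M (P i).dual.elt (P i).elt, ?_⟩
    rw [map_smul, map_sum]
    simp only [hf]
    change r * ∑ i, (P i).func (P i).elt = r
    rw [hP, mul_one]

end Tensor

end SuperModule

/-! ### The total fractions and partitions of unity inside them -/

namespace SuperModule

set_option linter.unusedSectionVars false

variable {R : Type u} [Ring R] {𝓡 : ZMod 2 → AddSubgroup R} [GradedRing 𝓡] [SuperCommutative 𝓡]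

variable (𝓡) in
/-- The canonical map from `R` to its total superring of fractions. -/
def fracHom : R →+* TotalFractions 𝓡 where
  toFun r := r /ₒ 1
  map_one' := OreLocalization.one_def.symm
  map_mul' _ _ := OreLocalization.mul_div_one.symm
  map_zero' := OreLocalization.zero_oreDiv _
  map_add' _ _ := OreLocalization.add_oreDiv.symm

theorem fracHom_apply (r : R) : fracHom 𝓡 r = r /ₒ 1 := rfl

theorem frac_smul (r : R) (x : TotalFractions 𝓡) : r • x = fracHom 𝓡 r * x :=
  smul_eq_oreDiv_mul _ r x

theorem fracHom_injective : Function.Injective (fracHom 𝓡) := by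
  rw [injective_iff_map_eq_zero]
  intro r hr
  obtain ⟨s, hs, h⟩ := (oreDiv_one_eq_zero _).1 hr
  exact (mem_nonZeroDivisors_iff.1 hs.1).1 _ h

theorem frac_cancel {s : R} (hs : s ∈ evenPart 𝓡 (nonZeroDivisors R)) {x y : TotalFractions 𝓡}
    (h : fracHom 𝓡 s * x = fracHom 𝓡 s * y) : x = y := by
  rw [← frac_smul, ← frac_smul] at h
  exact smul_left_cancel _ hs h

theorem exists_num_denom {i : ZMod 2} {x : TotalFractions 𝓡} (hx : x ∈ fracGr 𝓡 i) :
    ∃ s ∈ evenPart 𝓡 (nonZeroDivisors R), ∃ a ∈ 𝓡 i, fracHom 𝓡 s * x = fracHom 𝓡 a := by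
  obtain ⟨a, ha, s, rfl⟩ := hx
  exact ⟨s, s.2, a, ha, by rw [← frac_smul, smul_oreDiv_self]; rfl⟩

theorem exists_denom (x : TotalFractions 𝓡) :
    ∃ s ∈ evenPart 𝓡 (nonZeroDivisors R), ∃ a, fracHom 𝓡 s * x = fracHom 𝓡 a := by
  induction x using OreLocalization.ind with | _ a s
  exact ⟨s, s.2, a, by rw [← frac_smul, smul_oreDiv_self]; rfl⟩

theorem fracHom_mem {i : ZMod 2} {a : R} (ha : a ∈ 𝓡 i) : fracHom 𝓡 a ∈ fracGr 𝓡 i :=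
  ⟨a, ha, 1, rfl⟩

theorem mem_of_fracHom_mem {i : ZMod 2} {a : R} (ha : fracHom 𝓡 a ∈ fracGr 𝓡 i) : a ∈ 𝓡 i := by
  have h0 := grProj_unique (locGr_isCompl 𝓡 𝓡 (nonZeroDivisors R)) (fracHom_mem (rproj_mem 𝓡 0 a))
    (fracHom_mem (rproj_mem 𝓡 1 a)) (by
      change fracHom 𝓡 _ + fracHom 𝓡 _ = fracHom 𝓡 a
      rw [← map_add, rproj_add])
  have hi : fracHom 𝓡 a = fracHom 𝓡 (rproj 𝓡 i a) := by
    rw [← grProj_same (locGr_isCompl 𝓡 𝓡 (nonZeroDivisors R)) ha]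
    rcases zmod_two_cases i with rfl | rfl
    · exact h0.1
    · exact h0.2
  rw [fracHom_injective hi]
  exact rproj_mem 𝓡 i a

theorem fracHom_even_comm {s : R} (hs : s ∈ 𝓡 0) (y : TotalFractions 𝓡) :
    fracHom 𝓡 s * y = y * fracHom 𝓡 s := by
  obtain ⟨t, ht, b, hb⟩ := exists_denom y
  apply frac_cancel ht
  rw [← mul_assoc, ← map_mul, ← even_comm 𝓡 hs, map_mul, mul_assoc, hb, ← mul_assoc, hb, ← map_mul,
    ← map_mul, even_comm 𝓡 hs]

theorem frac_supercomm {i j : ZMod 2} {x y : TotalFractions 𝓡} (hx : x ∈ fracGr 𝓡 i)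
    (hy : y ∈ fracGr 𝓡 j) : x * y = ((-1 : ℤˣ) ^ (i * j)) • (y * x) := by
  obtain ⟨s, hs, a, ha, hsa⟩ := exists_num_denom hx
  obtain ⟨t, ht, b, hb, htb⟩ := exists_num_denom hy
  have h1 : fracHom 𝓡 (s * t) * (x * y) = fracHom 𝓡 (a * b) := by
    rw [map_mul, map_mul, ← hsa, ← htb, mul_assoc, mul_assoc, ← mul_assoc (fracHom 𝓡 t),
      fracHom_even_comm ht.2 x, mul_assoc]
  have h2 : fracHom 𝓡 (s * t) * (y * x) = fracHom 𝓡 (b * a) := by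
    rw [map_mul, map_mul, ← hsa, ← htb, ← map_mul, even_comm 𝓡 hs.2, map_mul, mul_assoc,
      mul_assoc, ← mul_assoc (fracHom 𝓡 s), fracHom_even_comm hs.2 y, mul_assoc]
  apply frac_cancel (mul_mem hs ht)
  rw [mul_smul_comm, h1, h2, SuperCommutative.comm ha hb, Units.smul_def, map_zsmul,
    Units.smul_def]

theorem frac_exists_add (y : TotalFractions 𝓡) :
    ∃ a ∈ fracGr 𝓡 0, ∃ b ∈ fracGr 𝓡 1, a + b = y :=
  exists_add_of_isCompl (locGr_isCompl 𝓡 𝓡 (nonZeroDivisors R)) y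

theorem frac_even_comm {x : TotalFractions 𝓡} (hx : x ∈ fracGr 𝓡 0) (y : TotalFractions 𝓡) :
    x * y = y * x := by
  obtain ⟨a, ha, b, hb, rfl⟩ := frac_exists_add y
  rw [mul_add, add_mul, frac_supercomm hx ha, frac_supercomm hx hb]
  simp

theorem frac_mul_mem {i j : ZMod 2} {x y : TotalFractions 𝓡} (hx : x ∈ fracGr 𝓡 i)
    (hy : y ∈ fracGr 𝓡 j) : x * y ∈ fracGr 𝓡 (i + j) := by
  obtain ⟨a, ha, s, rfl⟩ := hx
  obtain ⟨b, hb, t, rfl⟩ := hy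
  exact ⟨a * b, SetLike.mul_mem_graded ha hb, t * s,
    OreLocalization.oreDiv_mul_char a b s t a t (even_comm 𝓡 t.2.2 a)⟩

theorem frac_smul_mem {i j : ZMod 2} {r : R} {x : TotalFractions 𝓡} (hr : r ∈ 𝓡 i)
    (hx : x ∈ fracGr 𝓡 j) : r • x ∈ fracGr 𝓡 (i + j) := by
  rw [frac_smul]
  exact frac_mul_mem (fracHom_mem hr) hx

theorem frac_one_mem : (1 : TotalFractions 𝓡) ∈ fracGr 𝓡 0 := (one_mem (evenUnits 𝓡)).1

/-- An even fraction with zero annihilator in `R` is a unit. -/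
theorem exists_evenUnit {x : TotalFractions 𝓡} (hx : x ∈ fracGr 𝓡 0)
    (h : ∀ r : R, r • x = 0 → r = 0) :
    ∃ v : evenUnits 𝓡, ((v : (TotalFractions 𝓡)ˣ) : TotalFractions 𝓡) = x := by
  obtain ⟨s, hs, a, ha, hsa⟩ := exists_num_denom hx
  have hreg (r : R) (hr : r * a = 0) : r = 0 := by
    apply h
    apply frac_cancel hs
    rw [frac_smul, ← mul_assoc, ← map_mul, even_comm 𝓡 hs.2, map_mul, mul_assoc, hsa, ← map_mul,
      hr, map_zero, mul_zero]
  have haS : a ∈ evenPart 𝓡 (nonZeroDivisors R) :=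
    ⟨mem_nonZeroDivisors_iff.2 ⟨fun r hr => hreg r (by rwa [← even_comm 𝓡 ha]), hreg⟩, ha⟩
  -- Here `x = a / s` and the numerator has turned out regular, so `s / a` is a legitimate fraction.
  let y : TotalFractions 𝓡 := s /ₒ ⟨a, haS⟩
  have hy : y ∈ fracGr 𝓡 0 := ⟨s, hs.2, _, rfl⟩
  have hay : fracHom 𝓡 a * y = fracHom 𝓡 s := by
    rw [← frac_smul]
    exact smul_oreDiv_self _ s ⟨a, haS⟩
  have hxy : x * y = 1 := by
    apply frac_cancel hs
    rw [← mul_assoc, hsa, hay, mul_one]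
  exact ⟨⟨⟨x, y, hxy, by rw [← frac_even_comm hx, hxy]⟩, hx, hy⟩, rfl⟩

theorem mem_frac_one {x : TotalFractions 𝓡} :
    x ∈ (1 : Submodule R (TotalFractions 𝓡)) ↔ ∃ r, fracHom 𝓡 r = x := by
  rw [Submodule.one_eq_span, Submodule.mem_span_singleton]
  simp only [frac_smul, mul_one]

theorem frac_smul_mul (r : R) (x y : TotalFractions 𝓡) : (r • x) * y = r • (x * y) := by
  rw [frac_smul, frac_smul, mul_assoc]

theorem frac_even_mul_smul {x : TotalFractions 𝓡} (hx : x ∈ fracGr 𝓡 0) (r : R)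
    (y : TotalFractions 𝓡) : x * (r • y) = r • (x * y) := by
  rw [frac_even_comm hx, frac_smul_mul, frac_even_comm hx]

/-- Even elements of `N` and even fractions multiplying `N` into `R` which form a partition of
unity. -/
def FracPartition (N : Submodule R (TotalFractions 𝓡)) : Prop :=
  ∃ (ι : Type) (_ : Fintype ι) (m d : ι → TotalFractions 𝓡), (∀ i, m i ∈ N) ∧
    (∀ i, m i ∈ fracGr 𝓡 0) ∧ (∀ i, d i ∈ fracGr 𝓡 0) ∧
    (∀ i, ∀ x ∈ N, d i * x ∈ (1 : Submodule R (TotalFractions 𝓡))) ∧ ∑ i, d i * m i = 1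

/-- Multiplication by `dᵢ` is the functional, with values read in `R` through the injection `R →
K(R)`. The generator identity holds because even fractions are central. -/
theorem FracPartition.hasPartition {N : Submodule R (TotalFractions 𝓡)} (hN : IsGradedSubmodule N)
    (h : FracPartition N) : (subSuperModule N hN).HasPartition := by
  obtain ⟨ι, _, m, d, hm, hm0, hd0, hd, hsum⟩ := h
  have hd' (i) (x : N) : ∃ r, fracHom 𝓡 r = d i * x := mem_frac_one.1 (hd i x x.2)
  choose F hF using hd'
  refine ⟨ι, inferInstance, fun i =>
    { elt := ⟨m i, hm i⟩
      elt_mem := hm0 i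
      func :=
        { toFun := F i
          map_add' := fun x y => fracHom_injective (𝓡 := 𝓡) (by
            rw [map_add, hF, hF, hF, Submodule.coe_add, mul_add])
          map_smul' := fun r x => fracHom_injective (𝓡 := 𝓡) (by
            rw [RingHom.id_apply, smul_eq_mul, map_mul, hF, hF, Submodule.coe_smul,
              frac_even_mul_smul (hd0 i), frac_smul]) }
      func_mem := fun {k x} hx => mem_of_fracHom_mem (𝓡 := 𝓡) (by
        change fracHom 𝓡 (F i x) ∈ _
        rw [hF, ← zero_add k]
        exact frac_mul_mem (hd0 i) hx)
      func_smul := fun x => Subtype.ext (by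
        change F i x • m i = F i ⟨m i, hm i⟩ • (x : TotalFractions 𝓡)
        rw [frac_smul, frac_smul, hF, hF, mul_assoc, mul_assoc, frac_even_comm (hm0 i)]) }, ?_⟩
  apply fracHom_injective (𝓡 := 𝓡)
  rw [map_one, map_sum, ← hsum]
  exact Finset.sum_congr rfl fun i _ => hF i _

/-- The element `u` of a regular local generator is a unit of `K(R)₀`. The rank-one law `F(x) u =
F(u) x` then shows that each functional is multiplication by the fraction `F(u) u⁻¹`, and these are
the `dᵢ`. -/
theorem HasPartition.fracPartition (hR : NoetherianSuperring 𝓡)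
    {N : Submodule R (TotalFractions 𝓡)} {hN : IsGradedSubmodule N}
    (h : (subSuperModule N hN).HasPartition) : FracPartition N := by
  obtain ⟨P₀, hs⟩ := h.exists_regular hR
  have h' := h
  obtain ⟨ι, _, P, hP⟩ := h
  obtain ⟨u, hu⟩ := exists_evenUnit (x := (P₀.elt : TotalFractions 𝓡)) P₀.elt_mem fun r hr => by
    have h1 : r • P₀.elt = 0 := Subtype.ext hr
    have := congrArg P₀.func h1
    rw [map_smul, map_zero, smul_eq_mul] at this
    exact (mem_nonZeroDivisors_iff.1 hs.1).2 _ this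
  set v : TotalFractions 𝓡 := ((u⁻¹ : (TotalFractions 𝓡)ˣ) : TotalFractions 𝓡)
  have hv : v ∈ fracGr 𝓡 0 := u.2.2
  have huv : v * P₀.elt = 1 := by rw [← hu]; exact Units.inv_mul _
  have hvF (i) (x : N) : fracHom 𝓡 ((P i).func P₀.elt) * v * x = fracHom 𝓡 ((P i).func x) := by
    have h1 := congrArg Subtype.val
      (h'.apply_smul (P i).func (fun x hx => (P i).func_mem hx) P₀.elt_mem x)
    change (P i).func x • (P₀.elt : TotalFractions 𝓡) = (P i).func P₀.elt • (x : TotalFractions 𝓡)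
      at h1
    rw [frac_smul, frac_smul] at h1
    rw [← frac_even_comm hv, mul_assoc, ← h1, ← frac_even_comm (x := (P₀.elt : TotalFractions 𝓡)) P₀.elt_mem, ← mul_assoc, huv,
      one_mul]
  refine ⟨ι, inferInstance, fun i => (P i).elt, fun i => fracHom 𝓡 ((P i).func P₀.elt) * v,
    fun i => (P i).elt.2, fun i => (P i).elt_mem, fun i => ?_, fun i x hx => ?_, ?_⟩
  · have := frac_mul_mem (fracHom_mem ((P i).func_mem P₀.elt_mem)) hv
    rwa [zero_add] at this
  · exact mem_frac_one.2 ⟨_, (hvF i ⟨x, hx⟩).symm⟩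
  · simp only [hvF]
    rw [← map_sum, hP, map_one]

end SuperModule

open SuperModule

/-! ### The group of invertible submodules -/

section CartGroup

variable {R : Type u} [Ring R] {𝓡 : ZMod 2 → AddSubgroup R} [GradedRing 𝓡] [SuperCommutative 𝓡]

theorem isGradedSubmodule_span {s : Set (TotalFractions 𝓡)}
    (hs : ∀ x ∈ s, x ∈ fracGr 𝓡 0 ∨ x ∈ fracGr 𝓡 1) : IsGradedSubmodule (Submodule.span R s) := by
  intro x hx
  induction hx using Submodule.span_induction with
  | mem x hx =>
    rcases hs x hx with h | h
    · exact ⟨x, Submodule.subset_span hx, 0, zero_mem _, h, zero_mem _, add_zero x⟩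
    · exact ⟨0, zero_mem _, x, Submodule.subset_span hx, zero_mem _, h, zero_add x⟩
  | zero => exact ⟨0, zero_mem _, 0, zero_mem _, zero_mem _, zero_mem _, add_zero 0⟩
  | add x y _ _ hx hy =>
    obtain ⟨a, ha, b, hb, ha0, hb1, rfl⟩ := hx
    obtain ⟨c, hc, d, hd, hc0, hd1, rfl⟩ := hy
    exact ⟨a + c, add_mem ha hc, b + d, add_mem hb hd, add_mem ha0 hc0, add_mem hb1 hd1, by abel⟩
  | smul r x _ hx =>
    obtain ⟨a, ha, b, hb, ha0, hb1, rfl⟩ := hx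
    refine ⟨rproj 𝓡 0 r • a + rproj 𝓡 1 r • b,
      add_mem (Submodule.smul_mem _ _ ha) (Submodule.smul_mem _ _ hb),
      rproj 𝓡 0 r • b + rproj 𝓡 1 r • a,
      add_mem (Submodule.smul_mem _ _ hb) (Submodule.smul_mem _ _ ha),
      add_mem (frac_smul_mem (rproj_mem 𝓡 0 r) ha0) (frac_smul_mem (rproj_mem 𝓡 1 r) hb1),
      add_mem (frac_smul_mem (rproj_mem 𝓡 0 r) hb1) (frac_smul_mem (rproj_mem 𝓡 1 r) ha0), ?_⟩
    conv_rhs => rw [← rproj_add 𝓡 r]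
    simp only [frac_smul, map_add, mul_add, add_mul]
    abel

theorem isGradedSubmodule_one : IsGradedSubmodule (1 : Submodule R (TotalFractions 𝓡)) := by
  rw [Submodule.one_eq_span]
  exact isGradedSubmodule_span fun x hx => .inl (by rw [Set.mem_singleton_iff.1 hx]; exact frac_one_mem)

theorem IsGradedSubmodule.mul {M N : Submodule R (TotalFractions 𝓡)} (hM : IsGradedSubmodule M)
    (hN : IsGradedSubmodule N) : IsGradedSubmodule (M * N) := by
  intro x hx
  refine Submodule.mul_induction_on hx ?_ ?_
  · intro m hm n hn
    obtain ⟨a, ha, b, hb, ha0, hb1, rfl⟩ := hM m hm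
    obtain ⟨c, hc, d, hd, hc0, hd1, rfl⟩ := hN n hn
    refine ⟨a * c + b * d, add_mem (Submodule.mul_mem_mul ha hc) (Submodule.mul_mem_mul hb hd),
      a * d + b * c, add_mem (Submodule.mul_mem_mul ha hd) (Submodule.mul_mem_mul hb hc),
      add_mem (frac_mul_mem ha0 hc0) (frac_mul_mem hb1 hd1),
      add_mem (frac_mul_mem ha0 hd1) (frac_mul_mem hb1 hc0), ?_⟩
    rw [mul_add, add_mul, add_mul]
    abel
  · intro x y hx hy
    obtain ⟨a, ha, b, hb, ha0, hb1, rfl⟩ := hx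
    obtain ⟨c, hc, d, hd, hc0, hd1, rfl⟩ := hy
    exact ⟨a + c, add_mem ha hc, b + d, add_mem hb hd, add_mem ha0 hc0, add_mem hb1 hd1, by abel⟩

theorem isGradedSubmodule_fracInv (N : Submodule R (TotalFractions 𝓡)) :
    IsGradedSubmodule (fracInv N) := isGradedSubmodule_span fun _ hx => hx.1

/-- Homogeneous fractions commute up to sign, and submodules are stable under sign. Without gradings
this would fail, `K(R)` not being commutative. -/
theorem IsGradedSubmodule.mul_comm {M N : Submodule R (TotalFractions 𝓡)}
    (hM : IsGradedSubmodule M) (hN : IsGradedSubmodule N) : M * N = N * M := by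
  have key {M N : Submodule R (TotalFractions 𝓡)} (hM : IsGradedSubmodule M)
      (hN : IsGradedSubmodule N) : M * N ≤ N * M := by
    rw [Submodule.mul_le]
    intro m hm n hn
    obtain ⟨a, ha, b, hb, ha0, hb1, rfl⟩ := hM m hm
    obtain ⟨c, hc, d, hd, hc0, hd1, rfl⟩ := hN n hn
    have h {i j x y} (hx : x ∈ M) (hy : y ∈ N) (hxi : x ∈ fracGr 𝓡 i) (hyj : y ∈ fracGr 𝓡 j) :
        x * y ∈ N * M := by
      rw [frac_supercomm hxi hyj]
      exact units_smul_mem (N * M).toAddSubgroup _ (Submodule.mul_mem_mul hy hx)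
    rw [mul_add, add_mul, add_mul]
    exact add_mem (add_mem (h ha hc ha0 hc0) (h hb hc hb1 hc0))
      (add_mem (h ha hd ha0 hd1) (h hb hd hb1 hd1))
  exact le_antisymm (key hM hN) (key hN hM)

theorem frac_one_mul_mem {x y : TotalFractions 𝓡} (hx : x ∈ (1 : Submodule R (TotalFractions 𝓡)))
    (hy : y ∈ (1 : Submodule R (TotalFractions 𝓡))) :
    x * y ∈ (1 : Submodule R (TotalFractions 𝓡)) := by
  obtain ⟨a, rfl⟩ := mem_frac_one.1 hx
  obtain ⟨b, rfl⟩ := mem_frac_one.1 hy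
  exact mem_frac_one.2 ⟨a * b, map_mul _ _ _⟩

theorem fracPartition_one : FracPartition (1 : Submodule R (TotalFractions 𝓡)) :=
  ⟨Unit, inferInstance, fun _ => 1, fun _ => 1, fun _ => mem_frac_one.2 ⟨1, map_one _⟩,
    fun _ => frac_one_mem, fun _ => frac_one_mem, fun _ x hx => by rwa [one_mul], by simp⟩

theorem SuperModule.FracPartition.mul {M N : Submodule R (TotalFractions 𝓡)}
    (hM : FracPartition M) (hN : FracPartition N) : FracPartition (M * N) := by
  obtain ⟨ι, _, m, d, hm, hm0, hd0, hd, hmd⟩ := hM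
  obtain ⟨κ, _, n, e, hn, hn0, he0, he, hne⟩ := hN
  have h00 {x y : TotalFractions 𝓡} (hx : x ∈ fracGr 𝓡 0) (hy : y ∈ fracGr 𝓡 0) :
      x * y ∈ fracGr 𝓡 0 := by simpa using frac_mul_mem hx hy
  refine ⟨ι × κ, inferInstance, fun i => m i.1 * n i.2, fun i => d i.1 * e i.2,
    fun i => Submodule.mul_mem_mul (hm _) (hn _), fun i => h00 (hm0 _) (hn0 _),
    fun i => h00 (hd0 _) (he0 _), fun i x hx => ?_, ?_⟩
  · refine Submodule.mul_induction_on hx (fun a ha b hb => ?_) fun x y hx hy => ?_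
    · rw [mul_assoc, ← mul_assoc (e _), frac_even_comm (he0 _), mul_assoc, ← mul_assoc]
      exact frac_one_mul_mem (hd _ _ ha) (he _ _ hb)
    · rw [mul_add]; exact add_mem hx hy
  · have (i : ι × κ) : d i.1 * e i.2 * (m i.1 * n i.2) = d i.1 * m i.1 * (e i.2 * n i.2) := by
      rw [mul_assoc, ← mul_assoc (e _), frac_even_comm (he0 _), mul_assoc, ← mul_assoc]
    simp only [this]
    rw [Fintype.sum_prod_type]
    change ∑ i, ∑ j, d i * m i * (e j * n j) = 1
    rw [← Finset.sum_mul_sum, hmd, hne, mul_one]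

/-- The roles of `m` and `d` are exchanged. -/
theorem SuperModule.FracPartition.inv {N : Submodule R (TotalFractions 𝓡)}
    (hN : FracPartition N) : FracPartition (fracInv N) := by
  obtain ⟨ι, _, m, d, hm, hm0, hd0, hd, hmd⟩ := hN
  refine ⟨ι, inferInstance, d, m, fun i => Submodule.subset_span ⟨.inl (hd0 i), hd i⟩, hd0, hm0,
    fun i x hx => ?_, ?_⟩
  · induction hx using Submodule.span_induction with
    | mem x hx => rw [frac_even_comm (hm0 i)]; exact hx.2 _ (hm i)
    | zero => rw [mul_zero]; exact zero_mem _
    | add x y _ _ hx hy => rw [mul_add]; exact add_mem hx hy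
    | smul r x _ hx => rw [frac_even_mul_smul (hm0 i)]; exact Submodule.smul_mem _ _ hx
  · rw [← hmd]
    exact Finset.sum_congr rfl fun i _ => frac_even_comm (hm0 i) _

/-- One inclusion is the definition; the other is the relation `1 = ∑ dᵢ mᵢ`. -/
theorem SuperModule.FracPartition.fracInv_mul {N : Submodule R (TotalFractions 𝓡)}
    (hN : FracPartition N) : fracInv N * N = 1 := by
  apply le_antisymm
  · rw [Submodule.mul_le]
    intro d hd x hx
    induction hd using Submodule.span_induction with
    | mem d hd => exact hd.2 x hx
    | zero => rw [zero_mul]; exact zero_mem _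
    | add d e _ _ hd he => rw [add_mul]; exact add_mem hd he
    | smul r d _ hd => rw [frac_smul_mul]; exact Submodule.smul_mem _ _ hd
  · obtain ⟨ι, _, m, d, hm, hm0, hd0, hd, hmd⟩ := hN
    rw [Submodule.one_le, ← hmd]
    exact sum_mem fun i _ =>
      Submodule.mul_mem_mul (Submodule.subset_span ⟨.inl (hd0 i), hd i⟩) (hm i)

/-- A graded submodule of `K(R)` with a partition of unity, as an element of `Cart(R)`. -/
def Cart.ofPartition (N : Submodule R (TotalFractions 𝓡)) (hN : IsGradedSubmodule N)
    (h : FracPartition N) : Cart 𝓡 := ⟨N, hN, (h.hasPartition hN).isInvertible⟩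

theorem Cart.ext_submodule {M N : Cart 𝓡} (h : M.submodule = N.submodule) : M = N := by
  cases M; cases N; cases h; rfl

theorem Cart.hasPartition (h2 : (2 : R) ∈ nonZeroDivisors R)
    (hR : NoetherianSuperring 𝓡) (N : Cart 𝓡) : N.toSuperModule.HasPartition :=
  N.isInvertible.hasPartition h2 hR

theorem Cart.fracPartition (h2 : (2 : R) ∈ nonZeroDivisors R)
    (hR : NoetherianSuperring 𝓡) (N : Cart 𝓡) : FracPartition N.submodule :=
  (N.hasPartition h2 hR).fracPartition hR

/-- The group of invertible subsupermodules of `K(R)`. -/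
@[reducible]
def cartCommGroup (h2 : (2 : R) ∈ nonZeroDivisors R)
    (hR : NoetherianSuperring 𝓡) : CommGroup (Cart 𝓡) where
  mul M N := .ofPartition (M.submodule * N.submodule) (M.isGraded.mul N.isGraded)
    ((M.fracPartition h2 hR).mul (N.fracPartition h2 hR))
  one := .ofPartition 1 isGradedSubmodule_one fracPartition_one
  inv N := .ofPartition (fracInv N.submodule) (isGradedSubmodule_fracInv _)
    (N.fracPartition h2 hR).inv
  mul_assoc L M N := Cart.ext_submodule (mul_assoc L.submodule M.submodule N.submodule)
  one_mul N := Cart.ext_submodule (Submodule.one_mul N.submodule)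
  -- Odd scalars need not be central, so `N · 1 = N` uses the grading, through commutation with `1 ·
  -- N`.
  mul_one N := Cart.ext_submodule
    ((N.isGraded.mul_comm isGradedSubmodule_one).trans (Submodule.one_mul N.submodule))
  inv_mul_cancel N := Cart.ext_submodule (N.fracPartition h2 hR).fracInv_mul
  mul_comm M N := Cart.ext_submodule (M.isGraded.mul_comm N.isGraded)

end CartGroup

/-! ### Invertible supermodules as submodules of the total fractions -/

variable {R : Type u} [Ring R] {𝓡 : ZMod 2 → AddSubgroup R} [GradedRing 𝓡] [SuperCommutative 𝓡]

theorem SuperModule.isomorphic_of_injective {M : SuperModule 𝓡}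
    {N : Submodule R (TotalFractions 𝓡)} (hN : IsGradedSubmodule N)
    (f : M.carrier →ₗ[R] TotalFractions 𝓡) (hf : ∀ i, ∀ x ∈ M.gr i, f x ∈ fracGr 𝓡 i)
    (hinj : Function.Injective f) (hrange : LinearMap.range f = N) :
    M.Isomorphic (subSuperModule N hN) := by
  subst hrange
  exact ⟨LinearEquiv.ofInjective f hinj, fun i x hx => hf i x hx⟩

/-- The tensor product of two submodules of `K(R)` is their product. -/
theorem Cart.tensor_isomorphic (h2 : (2 : R) ∈ nonZeroDivisors R) (hR : NoetherianSuperring 𝓡)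
    {M N : SuperModule 𝓡} {C D : Cart 𝓡} (hM : M.Isomorphic C.toSuperModule)
    (hN : N.Isomorphic D.toSuperModule) (hCD : IsGradedSubmodule (C.submodule * D.submodule)) :
    (M.tensor N).Isomorphic (subSuperModule (C.submodule * D.submodule) hCD) := by
  have hMP := (C.hasPartition h2 hR).of_isomorphic hM.symm
  have hNP := (D.hasPartition h2 hR).of_isomorphic hN.symm
  obtain ⟨e, he⟩ := hM
  obtain ⟨e', he'⟩ := hN
  let f : M.carrier →ₗ[R] TotalFractions 𝓡 := C.submodule.subtype.comp e.toLinearMap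
  let g : N.carrier →ₗ[R] TotalFractions 𝓡 := D.submodule.subtype.comp e'.toLinearMap
  have hf (i) (x) (hx : x ∈ M.gr i) : f x ∈ fracGr 𝓡 i := he i x hx
  have hg (i) (x) (hx : x ∈ N.gr i) : g x ∈ fracGr 𝓡 i := he' i x hx
  have hfinj : Function.Injective f := Subtype.val_injective.comp e.injective
  have hginj : Function.Injective g := Subtype.val_injective.comp e'.injective
  let β := mulBiadditive M N f.toAddMonoidHom g.toAddMonoidHom
  have hβ (m n) : β m n = f m * g n := rfl
  have hsmul (r : R) (m : M.carrier) (n : N.carrier) : β (r • m) n = r • β m n := by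
    rw [hβ, hβ, map_smul, frac_smul_mul]
  have hbal (i j : ZMod 2) (r : R) (m : M.carrier) (n : N.carrier) (hr : r ∈ 𝓡 i)
      (hm : m ∈ M.gr j) : ((-1 : ℤˣ) ^ (i * j)) • r • β m n = β m (r • n) := by
    rw [hβ, hβ, map_smul, frac_smul, frac_smul, ← mul_assoc, ← mul_assoc,
      frac_supercomm (hf j m hm) (fracHom_mem hr), mul_comm j i, smul_mul_assoc]
  let μ := tensorLift β hsmul hbal
  have hμ (m n) : μ (tmk M N m n) = f m * g n := rfl
  refine isomorphic_of_injective hCD μ (fun i x hx => tensorLift_mem M N β hsmul hbal (fracGr 𝓡)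
    (fun i j m n hm hn => frac_mul_mem (hf i m hm) (hg j n hn)) hx) ?_ ?_
  · obtain ⟨P, hP⟩ := hMP.exists_regular hR
    obtain ⟨Q, hQ⟩ := hNP.exists_regular hR
    have hreg {r : R} (hr : r • Q.elt = 0) : r = 0 := by
      have := congrArg Q.func hr
      rw [map_smul, map_zero, smul_eq_mul] at this
      exact (mem_nonZeroDivisors_iff.1 hQ.1).2 _ this
    have hreg' {r : R} (hr : r • P.elt = 0) : r = 0 := by
      have := congrArg P.func hr
      rw [map_smul, map_zero, smul_eq_mul] at this
      exact (mem_nonZeroDivisors_iff.1 hP.1).2 _ this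
    obtain ⟨v, hv⟩ := exists_evenUnit (hg 0 _ Q.elt_mem) fun r hr => hreg (hginj (by
      rw [map_smul, hr, map_zero]))
    -- Let `p`, `q` be regular generators and `H` the functional of `P ⊗ Q`, so `H(y) (p ⊗ q) = P(p)
    -- Q(q) y`. If `μ(y) = 0`, then `H(y) f(p) g(q) = 0`. Cancelling the unit `g(q)` and then
    -- `f(p)`, whose annihilator is zero, gives `H(y) = 0`. So the regular element `P(p) Q(q)` kills
    -- `y`, which must vanish.
    rw [injective_iff_map_eq_zero]
    intro y hy
    have h0 := congrArg μ ((P.tensor Q).func_smul y)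
    rw [map_smul, map_smul, hy] at h0
    change (P.tensor Q).func y • (f P.elt * g Q.elt) = _ • 0 at h0
    rw [frac_smul, frac_smul, mul_zero, ← mul_assoc, ← frac_smul, ← hv, Units.mul_left_eq_zero,
      ← map_smul] at h0
    have hH := hreg' (hfinj (h0.trans (map_zero f).symm))
    refine regular_smul_eq_zero (hMP.tensor hNP) (mul_mem hP.1 hQ.1) ?_
    rw [← P.tensor_func_tmk Q]
    exact ((P.tensor Q).func_smul y).symm.trans (by rw [hH, zero_smul])
  · apply le_antisymm
    · rintro _ ⟨y, rfl⟩
      induction y using tensor_induction with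
      | h0 => rw [map_zero]; exact zero_mem _
      | hadd x y hx hy => rw [map_add]; exact add_mem hx hy
      | h m n => exact Submodule.mul_mem_mul (e m).2 (e' n).2
    · rw [Submodule.mul_le]
      intro x hx y hy
      refine ⟨tmk M N (e.symm ⟨x, hx⟩) (e'.symm ⟨y, hy⟩), ?_⟩
      rw [hμ]
      simp [f, g]

/-- Every invertible supermodule is isomorphic to a submodule of `K(R)`. -/
theorem SuperModule.IsInvertible.exists_cart (h2 : (2 : R) ∈ nonZeroDivisors R)
    (hR : NoetherianSuperring 𝓡) {M : SuperModule 𝓡} (hM : M.IsInvertible) :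
    ∃ C : Cart 𝓡, M.Isomorphic C.toSuperModule := by
  have hMP := hM.hasPartition h2 hR
  obtain ⟨P, hP⟩ := hMP.exists_regular hR
  let f : M.carrier →ₗ[R] TotalFractions 𝓡 :=
    { toFun := fun x => fracHom 𝓡 (P.func x)
      map_add' := fun x y => by rw [map_add, map_add]
      map_smul' := fun r x => by rw [map_smul, smul_eq_mul, map_mul, RingHom.id_apply, frac_smul] }
  have hf (i) (x) (hx : x ∈ M.gr i) : f x ∈ fracGr 𝓡 i := fracHom_mem (P.func_mem hx)
  -- If `F(x) = 0` then `F(m) x = F(x) m = 0`, and the regular `F(m)` acts injectively on `M`.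
  have hinj : Function.Injective f := by
    rw [injective_iff_map_eq_zero]
    intro x hx
    have : P.func x = 0 := fracHom_injective (𝓡 := 𝓡) (by rw [map_zero]; exact hx)
    refine regular_smul_eq_zero hMP hP.1 ?_
    rw [← P.func_smul, this, zero_smul]
  have hgr : IsGradedSubmodule (LinearMap.range f) := by
    rintro _ ⟨x, rfl⟩
    exact ⟨_, ⟨_, rfl⟩, _, ⟨_, rfl⟩, hf 0 _ (M.proj_mem 0 x), hf 1 _ (M.proj_mem 1 x),
      by rw [← map_add, M.proj_add]⟩
  have hiso := isomorphic_of_injective hgr f hf hinj rfl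
  exact ⟨⟨_, hgr, (hMP.of_isomorphic hiso).isInvertible⟩, hiso⟩

/-- The submodule `vR` of `K(R)`. -/
def Cart.principal (v : evenUnits 𝓡) : Cart 𝓡 :=
  .ofPartition (Submodule.span R {((v : (TotalFractions 𝓡)ˣ) : TotalFractions 𝓡)})
    (isGradedSubmodule_span fun x hx => .inl (by rw [Set.mem_singleton_iff.1 hx]; exact v.2.1))
    ⟨Unit, inferInstance, fun _ => (v : (TotalFractions 𝓡)ˣ),
      fun _ => ((v⁻¹ : evenUnits 𝓡) : (TotalFractions 𝓡)ˣ),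
      fun _ => Submodule.mem_span_singleton_self _, fun _ => v.2.1, fun _ => v.2.2,
      fun _ x hx => by
        obtain ⟨r, rfl⟩ := Submodule.mem_span_singleton.1 hx
        rw [frac_even_mul_smul v⁻¹.2.1]
        exact Submodule.smul_mem _ _ (by simpa using mem_frac_one.2 ⟨1, map_one _⟩),
      by simp⟩

theorem Cart.coe_principal (v : evenUnits 𝓡) :
    ((Cart.principal v).submodule : Set (TotalFractions 𝓡)) =
      Set.range fun r : R => ((v : (TotalFractions 𝓡)ˣ) : TotalFractions 𝓡) * (r /ₒ 1) := by
  ext x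
  simp only [Cart.principal, Cart.ofPartition, SetLike.mem_coe, Submodule.mem_span_singleton,
    Set.mem_range, frac_even_comm v.2.1, frac_smul, fracHom_apply]

theorem Cart.principal_isomorphic (v : evenUnits 𝓡) :
    (SuperModule.self 𝓡).Isomorphic (Cart.principal v).toSuperModule := by
  refine isomorphic_of_injective _ (LinearMap.toSpanSingleton R (TotalFractions 𝓡)
    ((v : (TotalFractions 𝓡)ˣ) : TotalFractions 𝓡)) (fun i r hr => ?_) ?_ ?_
  · rw [← add_zero i]
    exact frac_smul_mem hr v.2.1
  · rw [injective_iff_map_eq_zero]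
    intro r hr
    rw [LinearMap.toSpanSingleton_apply, frac_smul, Units.mul_left_eq_zero] at hr
    exact fracHom_injective (hr.trans (map_zero _).symm)
  · exact LinearMap.range_toSpanSingleton _

/-- Only the principal submodules `vR` of `K(R)` are isomorphic to `R`. -/
theorem Cart.exists_eq_principal {C : Cart 𝓡}
    (h : (SuperModule.self 𝓡).Isomorphic C.toSuperModule) : ∃ v, Cart.principal v = C := by
  obtain ⟨e, he⟩ := h
  have he1 (r : R) : ((e r : C.submodule) : TotalFractions 𝓡) =
      r • ((e (1 : R) : C.submodule) : TotalFractions 𝓡) := by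
    have := congrArg Subtype.val (e.map_smul r (1 : R))
    rwa [smul_eq_mul, mul_one] at this
  -- The image of 1 is even and, by injectivity, has zero annihilator in `R`; so it is an even unit.
  obtain ⟨v, hv⟩ := exists_evenUnit (x := ((e (1 : R) : C.submodule) : TotalFractions 𝓡))
    (he 0 _ (SetLike.one_mem_graded 𝓡)) fun r hr => by
      rw [← he1] at hr
      exact (map_eq_zero_iff e e.injective).1 (Subtype.ext hr)
  refine ⟨v, Cart.ext_submodule (le_antisymm ?_ fun x hx => ?_)⟩
  · refine (Submodule.span_singleton_le_iff_mem _ _).2 ?_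
    rw [hv]
    exact (e (1 : R)).2
  · refine Submodule.mem_span_singleton.2 ⟨e.symm ⟨x, hx⟩, ?_⟩
    rw [hv, ← he1, e.apply_symm_apply]

/-! ### The group of isomorphism classes -/

theorem Pic.mk_eq_mk {M N : SuperModule 𝓡} {hM : M.IsInvertible} {hN : N.IsInvertible} :
    Pic.mk M hM = Pic.mk N hN ↔ M.Isomorphic N := Quotient.eq (r := picSetoid 𝓡)

/-- The class of a submodule of `K(R)`. -/
def Cart.toPic (C : Cart 𝓡) : Pic 𝓡 := Pic.mk C.toSuperModule C.isInvertible

theorem Cart.toPic_surjective (h2 : (2 : R) ∈ nonZeroDivisors R) (hR : NoetherianSuperring 𝓡) :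
    Function.Surjective (Cart.toPic (𝓡 := 𝓡)) := by
  intro x
  induction x using Quotient.inductionOn with | _ M
  obtain ⟨C, hC⟩ := M.2.exists_cart h2 hR
  exact ⟨C, Pic.mk_eq_mk.2 hC.symm⟩

theorem SuperModule.IsInvertible.tensor (h2 : (2 : R) ∈ nonZeroDivisors R)
    (hR : NoetherianSuperring 𝓡) {M N : SuperModule 𝓡} (hM : M.IsInvertible)
    (hN : N.IsInvertible) : (M.tensor N).IsInvertible :=
  ((hM.hasPartition h2 hR).tensor (hN.hasPartition h2 hR)).isInvertible

theorem SuperModule.IsInvertible.dual (h2 : (2 : R) ∈ nonZeroDivisors R)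
    (hR : NoetherianSuperring 𝓡) {M : SuperModule 𝓡} (hM : M.IsInvertible) :
    M.dual.IsInvertible :=
  (hM.hasPartition h2 hR).dual.isInvertible

/-- Both tensor products are isomorphic to the product of the same two submodules of `K(R)`. -/
theorem SuperModule.Isomorphic.tensor (h2 : (2 : R) ∈ nonZeroDivisors R)
    (hR : NoetherianSuperring 𝓡)
    {M M' N N' : SuperModule 𝓡} (hM' : M'.IsInvertible)
    (hN' : N'.IsInvertible) (hM : M.Isomorphic M') (hN : N.Isomorphic N') :
    (M.tensor N).Isomorphic (M'.tensor N') := by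
  obtain ⟨C, hC⟩ := hM'.exists_cart h2 hR
  obtain ⟨D, hD⟩ := hN'.exists_cart h2 hR
  have hCD := C.isGraded.mul D.isGraded
  exact (Cart.tensor_isomorphic h2 hR (hM.trans hC) (hN.trans hD) hCD).trans
    (Cart.tensor_isomorphic h2 hR hC hD hCD).symm

/-- The product of classes, given by the tensor product. -/
def Pic.tensor (h2 : (2 : R) ∈ nonZeroDivisors R)
    (hR : NoetherianSuperring 𝓡) : Pic 𝓡 → Pic 𝓡 → Pic 𝓡 :=
  Quotient.map₂ (sa := picSetoid 𝓡) (sb := picSetoid 𝓡) (sc := picSetoid 𝓡)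
    (fun M N => ⟨M.1.tensor N.1, M.2.tensor h2 hR N.2⟩)
    fun _ M' hM _ N' hN => SuperModule.Isomorphic.tensor h2 hR M'.2 N'.2 hM hN

theorem Cart.toPic_mul (h2 : (2 : R) ∈ nonZeroDivisors R)
    (hR : NoetherianSuperring 𝓡)
    (C D : Cart 𝓡) :
    letI := cartCommGroup h2 hR
    (C * D).toPic = Pic.tensor h2 hR C.toPic D.toPic :=
  (Pic.mk_eq_mk (hM := C.isInvertible.tensor h2 hR D.isInvertible)).2
    (Cart.tensor_isomorphic h2 hR (.refl _) (.refl _) (C.isGraded.mul D.isGraded)) |>.symm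

/-- The group of classes of invertible supermodules. -/
@[reducible]
noncomputable def picCommGroup (h2 : (2 : R) ∈ nonZeroDivisors R)
    (hR : NoetherianSuperring 𝓡) : CommGroup (Pic 𝓡) :=
  letI := cartCommGroup h2 hR
  have hs := Cart.toPic_surjective h2 hR
  { mul := Pic.tensor h2 hR
    one := (1 : Cart 𝓡).toPic
    -- Any preimage in Cart may be inverted; uniqueness of inverses identifies the result with the
    -- class of the dual.
    inv := fun x => ((hs x).choose⁻¹).toPic
    mul_assoc := by
      intro x y z
      obtain ⟨x, rfl⟩ := hs x
      obtain ⟨y, rfl⟩ := hs y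
      obtain ⟨z, rfl⟩ := hs z
      change Pic.tensor h2 hR (Pic.tensor h2 hR _ _) _ = Pic.tensor h2 hR _ (Pic.tensor h2 hR _ _)
      simp only [← Cart.toPic_mul, mul_assoc]
    one_mul := by
      intro x
      obtain ⟨x, rfl⟩ := hs x
      change Pic.tensor h2 hR (1 : Cart 𝓡).toPic _ = _
      rw [← Cart.toPic_mul, one_mul]
    mul_one := by
      intro x
      obtain ⟨x, rfl⟩ := hs x
      change Pic.tensor h2 hR _ (1 : Cart 𝓡).toPic = _
      rw [← Cart.toPic_mul, mul_one]
    inv_mul_cancel := by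
      intro x
      change Pic.tensor h2 hR _ x = (1 : Cart 𝓡).toPic
      have := Cart.toPic_mul h2 hR (hs x).choose⁻¹ (hs x).choose
      rw [inv_mul_cancel, (hs x).choose_spec] at this
      exact this.symm
    mul_comm := by
      intro x y
      obtain ⟨x, rfl⟩ := hs x
      obtain ⟨y, rfl⟩ := hs y
      change Pic.tensor h2 hR _ _ = Pic.tensor h2 hR _ _
      rw [← Cart.toPic_mul, mul_comm, Cart.toPic_mul] }

theorem isomorphic_self_one :
    (SuperModule.self 𝓡).Isomorphic
      (Cart.ofPartition (𝓡 := 𝓡) 1 isGradedSubmodule_one fracPartition_one).toSuperModule := by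
  have h := Cart.principal_isomorphic (1 : evenUnits 𝓡)
  have e : Cart.principal (1 : evenUnits 𝓡) =
      Cart.ofPartition 1 isGradedSubmodule_one fracPartition_one :=
    Cart.ext_submodule Submodule.one_eq_span.symm
  rwa [e] at h

/-! ### The kernel and the ideal class group -/

theorem mainTheorem9 {R : Type u} [Ring R] [Nontrivial R] (𝓡 : ZMod 2 → AddSubgroup R)
    [GradedRing 𝓡] [SuperCommutative 𝓡] (two_regular : (2 : R) ∈ nonZeroDivisors R)
    (noetherian : NoetherianSuperring 𝓡) :
    ∃ (hself : (SuperModule.self 𝓡).IsInvertible)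
      (htensor : ∀ M N : SuperModule 𝓡, M.IsInvertible → N.IsInvertible →
        (M.tensor N).IsInvertible)
      (hdual : ∀ M : SuperModule 𝓡, M.IsInvertible → M.dual.IsInvertible)
      (_ : CommGroup (Pic 𝓡)) (_ : CommGroup (Cart 𝓡))
      (ψ : Cart 𝓡 →* Pic 𝓡) (δ : evenUnits 𝓡 →* Cart 𝓡),
      -- the group structure of `Pic₊(R)`: tensor product, class of `R`, class of the dual
      (∀ (M N : SuperModule 𝓡) (hM : M.IsInvertible) (hN : N.IsInvertible),
        Pic.mk M hM * Pic.mk N hN = Pic.mk (M.tensor N) (htensor M N hM hN)) ∧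
      (1 : Pic 𝓡) = Pic.mk (SuperModule.self 𝓡) hself ∧
      (∀ (M : SuperModule 𝓡) (hM : M.IsInvertible),
        (Pic.mk M hM)⁻¹ = Pic.mk M.dual (hdual M hM)) ∧
      -- the group structure of `Cart(R)`: product of submodules of `K(R)`, `R`, and `N⁻¹`
      (∀ M N : Cart 𝓡, (M * N).submodule = M.submodule * N.submodule) ∧
      (1 : Cart 𝓡).submodule = 1 ∧
      (∀ N : Cart 𝓡, (N⁻¹).submodule = fracInv N.submodule) ∧
      -- `ψ` sends an invertible subsupermodule of `K(R)` to its isomorphism class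
      (∀ N : Cart 𝓡, ψ N = Pic.mk N.toSuperModule N.isInvertible) ∧
      -- `δ` sends an even unit `v` of `K(R)` to `v R`
      (∀ v : evenUnits 𝓡, ((δ v).submodule : Set (TotalFractions 𝓡)) =
        Set.range fun r : R => ((v : (TotalFractions 𝓡)ˣ) : TotalFractions 𝓡) * (r /ₒ 1)) ∧
      Function.Surjective ψ ∧
      (ψ.ker : Set (Cart 𝓡)) = {N | ∃ v : evenUnits 𝓡,
        (N.submodule : Set (TotalFractions 𝓡)) =
          Set.range fun r : R => ((v : (TotalFractions 𝓡)ˣ) : TotalFractions 𝓡) * (r /ₒ 1)} ∧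
      -- the ideal class group `Cart(R) / K(R)₀ˣ` is canonically isomorphic to `Pic₊(R)`
      ∃ e : Cart 𝓡 ⧸ δ.range ≃* Pic 𝓡, ∀ N : Cart 𝓡, e (QuotientGroup.mk N) = ψ N := by
  let _ := cartCommGroup two_regular noetherian
  let _ := picCommGroup two_regular noetherian
  let ψ : Cart 𝓡 →* Pic 𝓡 :=
    { toFun := Cart.toPic
      map_one' := rfl
      map_mul' := Cart.toPic_mul two_regular noetherian }
  let δ : evenUnits 𝓡 →* Cart 𝓡 :=
    MonoidHom.mk' Cart.principal fun v w => Cart.ext_submodule (le_antisymm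
      ((Submodule.span_singleton_le_iff_mem _ _).2
        (Submodule.mul_mem_mul (Submodule.mem_span_singleton_self _)
          (Submodule.mem_span_singleton_self _)))
      (Submodule.mul_le.2 fun x hx y hy => by
        obtain ⟨r, rfl⟩ := Submodule.mem_span_singleton.1 hx
        obtain ⟨s, rfl⟩ := Submodule.mem_span_singleton.1 hy
        rw [frac_smul_mul, frac_even_mul_smul v.2.1]
        exact Submodule.smul_mem _ _ (Submodule.smul_mem _ _
          (Submodule.mem_span_singleton_self _))))
  have hself : (SuperModule.self 𝓡).IsInvertible := hasPartition_self.isInvertible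
  have hone : (1 : Pic 𝓡) = Pic.mk (SuperModule.self 𝓡) hself :=
    Pic.mk_eq_mk.2 isomorphic_self_one.symm
  -- A trivial class means an isomorphism with `R`, which for a submodule of `K(R)` means being
  -- generated by an even unit.
  have hker (C : Cart 𝓡) : ψ C = 1 ↔ ∃ v, Cart.principal v = C := by
    rw [hone]
    refine ⟨fun h => Cart.exists_eq_principal (Pic.mk_eq_mk.1 h).symm, ?_⟩
    rintro ⟨v, rfl⟩
    exact Pic.mk_eq_mk.2 (Cart.principal_isomorphic v).symm
  have hsurj : Function.Surjective ψ := Cart.toPic_surjective two_regular noetherian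
  have hrange : δ.range = ψ.ker := by
    ext C
    exact (hker C).symm
  refine ⟨hself, fun M N hM hN => hM.tensor two_regular noetherian hN,
    fun M hM => hM.dual two_regular noetherian, inferInstance, inferInstance, ψ, δ,
    fun M N hM hN => rfl, hone, fun M hM => ?_, fun M N => rfl, rfl, fun N => rfl, fun N => rfl,
    Cart.coe_principal, hsurj, ?_,
    (QuotientGroup.quotientMulEquivOfEq hrange).trans
      (QuotientGroup.quotientKerEquivOfSurjective ψ hsurj), fun N => rfl⟩
  -- The dual is the inverse because evaluation gives `Mᵛ ⊗ M ≃ R`.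
  · symm
    apply eq_inv_of_mul_eq_one_left
    rw [hone]
    exact Pic.mk_eq_mk.2 (hM.hasPartition two_regular noetherian).dual_tensor_isomorphic
  · ext C
    change ψ C = 1 ↔ ∃ v : evenUnits 𝓡, _
    rw [hker]
    refine exists_congr fun v => ?_
    rw [← Cart.coe_principal, SetLike.coe_set_eq]
    exact ⟨fun h => by rw [h], fun h => Cart.ext_submodule h.symm⟩
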